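/- Let $n\ge 1$, $A\in\mathbb{R}^{n\times n}$, $\epsilon>0$, and let $s$ be a nonnegative integer. Let $\widehat A$ be $A$ with all entries of absolute value smaller than $\epsilon/(2n)$ replaced by $0$. If $\widehat A\neq 0$, draw $s$ i.i.d. positions $(i_1,j_1),\dots,(i_s,j_s)\in[n]\times[n]$ with $\mathbb{P}\left((i_t,j_t)=(i,j)\right)=p_{ij}:=\widehat A_{ij}^2/\|\widehat A\|_F^2$ and put $$\widetilde A=\frac1s\sum_{t=1}^s\frac{\widehat A_{i_tj_t}}{p_{i_tj_t}}\,e_{i_t}e_{j_t}^T$$ (the zero matrix if $s=0$). If $\widehat A=0$, put $\widetilde A=0$. Here $e_1,\dots,e_n$ is the standard basis, $\|\cdot\|_F$ is the Frobenius norm and $\|\cdot\|$ the spectral norm. (1) If $s\ge \dfrac{28\,n\ln(\sqrt2\,n)}{\epsilon^2}\|A\|_F^2$ (in particular, if equality holds), then with probability at least $1-1/n$ we have $\|A-\widetilde A\|\le\epsilon$; moreover, $\widetilde A$ always has at most $s$ nonzero entries. (2) The construction of $\widetilde A$ can be implemented in one pass over the entries of $A$ with $O(s)$ memory: there is an absolute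 constant $C$ such that for all $n\ge1$, $\epsilon>0$ and $s\ge 0$ there is a randomized program (depending only on $n,\epsilon,s$) with at most $Cs$ registers, each holding an index or a real number, which reads the triples $(i,j,A_{ij})$, $(i,j)\in[n]\times[n]$, once each. After each triple it executes a fixed loop-free code consisting of copying, real arithmetic, comparisons and coin flips whose bias is computed from the registers. For every $A\in\mathbb{R}^{n\times n}$ and every order in which the triples arrive, the matrix that it outputs (as a list of row, column, value triples, computed from the final registers) has exactly the distribution of $\widetilde A$. -/

import Mathlib

noncomputable section

namespace Sparsify

/-! ## The element-wise sparsification algorithm -/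

/-- The squared Frobenius norm. -/
def frobSq {n : ℕ} (A : Matrix (Fin n) (Fin n) ℝ) : ℝ :=
  ∑ i, ∑ j, A i j ^ 2

/-- The spectral norm: the operator norm of `M` acting on Euclidean space. -/
def specNorm {n : ℕ} (M : Matrix (Fin n) (Fin n) ℝ) : ℝ :=
  ‖Matrix.toEuclideanCLM (n := Fin n) (𝕜 := ℝ) M‖

/-- The number of non-zero entries of a matrix. -/
def nnz {n : ℕ} (M : Matrix (Fin n) (Fin n) ℝ) : ℕ :=
  Set.ncard {x : Fin n × Fin n | M x.1 x.2 ≠ 0}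

/-- `A` with all entries of absolute value smaller than `ε / (2 n)` zeroed out. -/
def trunc {n : ℕ} (A : Matrix (Fin n) (Fin n) ℝ) (ε : ℝ) : Matrix (Fin n) (Fin n) ℝ :=
  Matrix.of fun i j => if |A i j| < ε / (2 * n) then 0 else A i j

/-- The sampling probability of the entry at position `x = (i, j)`:
its squared magnitude over the squared Frobenius norm. -/
def prob {n : ℕ} (B : Matrix (Fin n) (Fin n) ℝ) (x : Fin n × Fin n) : ℝ :=
  B x.1 x.2 ^ 2 / frobSq B

theorem frobSq_ne_zero {n : ℕ} {B : Matrix (Fin n) (Fin n) ℝ} (hB : B ≠ 0) :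
    frobSq B ≠ 0 := by
  intro h
  apply hB
  have h0 := (Finset.sum_eq_zero_iff_of_nonneg
    (fun i _ => Finset.sum_nonneg fun j _ => sq_nonneg (B i j))).1 h
  ext i j
  have h1 := (Finset.sum_eq_zero_iff_of_nonneg (fun j _ => sq_nonneg (B i j))).1
    (h0 i (Finset.mem_univ i)) j (Finset.mem_univ j)
  simpa using h1

theorem frobSq_nonneg {n : ℕ} (B : Matrix (Fin n) (Fin n) ℝ) : 0 ≤ frobSq B :=
  Finset.sum_nonneg fun _ _ => Finset.sum_nonneg fun _ _ => sq_nonneg _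

theorem sum_prob {n : ℕ} {B : Matrix (Fin n) (Fin n) ℝ} (hB : B ≠ 0) :
    ∑ x, ENNReal.ofReal (prob B x) = 1 := by
  rw [← ENNReal.ofReal_sum_of_nonneg (f := fun x => prob B x)
    (fun x _ => div_nonneg (sq_nonneg _) (frobSq_nonneg B))]
  unfold prob
  rw [← Finset.sum_div, Fintype.sum_prod_type]
  change ENNReal.ofReal (frobSq B / frobSq B) = 1
  rw [div_self (frobSq_ne_zero hB), ENNReal.ofReal_one]

/-- The law of one sampled position. -/
def indexLaw {n : ℕ} (B : Matrix (Fin n) (Fin n) ℝ) (hB : B ≠ 0) : PMF (Fin n × Fin n) :=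
  PMF.ofFintype (fun x => ENNReal.ofReal (prob B x)) (sum_prob hB)

/-- The law of `s` independent draws from `p`. -/
def iid {α : Type} (p : PMF α) : (s : ℕ) → PMF (Fin s → α)
  | 0 => PMF.pure Fin.elim0
  | s + 1 => p.bind fun a => (iid p s).map fun f => Fin.cons a f

/-- The rescaled average `(1 / s) ∑ t, (B i_t j_t / p i_t j_t) e_{i_t} e_{j_t}ᵀ`. -/
def sketch {n : ℕ} (B : Matrix (Fin n) (Fin n) ℝ) (s : ℕ) (x : Fin s → Fin n × Fin n) :
    Matrix (Fin n) (Fin n) ℝ :=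
  (1 / (s : ℝ)) • ∑ t, Matrix.single (x t).1 (x t).2 (B (x t).1 (x t).2 / prob B (x t))

open Classical in
/-- The law of the output of the algorithm with `s` samples. If every entry is zeroed out
there is nothing to sample from, and the output is the zero matrix. -/
def sketchLaw {n : ℕ} (A : Matrix (Fin n) (Fin n) ℝ) (ε : ℝ) (s : ℕ) :
    PMF (Matrix (Fin n) (Fin n) ℝ) :=
  if h : trunc A ε = 0 then PMF.pure 0
  else (iid (indexLaw (trunc A ε) h) s).map (sketch (trunc A ε) s)

/-! ## Randomized one-pass programs -/

/-- The memory of a program: `k` registers for indices and `m` registers for reals. -/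
structure Mem (k m : ℕ) where
  idx : Fin k → ℕ
  val : Fin m → ℝ

/-- Arithmetic expressions in the real registers. -/
inductive RExpr (m : ℕ) where
  | const (c : ℝ)
  | reg (r : Fin m)
  | add (e f : RExpr m)
  | sub (e f : RExpr m)
  | mul (e f : RExpr m)
  | div (e f : RExpr m)

/-- The value of an expression (`x / 0` evaluates to `0`). -/
def RExpr.eval {m : ℕ} (v : Fin m → ℝ) : RExpr m → ℝ
  | .const c => c
  | .reg r => v r
  | .add e f => e.eval v + f.eval v
  | .sub e f => e.eval v - f.eval v
  | .mul e f => e.eval v * f.eval v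
  | .div e f => e.eval v / f.eval v

/-- The code that is executed on every item `(i, j, A i j)` of the stream. -/
inductive Cmd (k m : ℕ) where
  | skip
  | seq (c d : Cmd k m)
  /-- Store the row index of the current item. -/
  | readRow (a : Fin k)
  /-- Store the column index of the current item. -/
  | readCol (a : Fin k)
  /-- Store the value of the current item. -/
  | readVal (r : Fin m)
  /-- Copy the index register `b` to `a`. -/
  | copy (a b : Fin k)
  /-- Store the value of an expression. -/
  | set (r : Fin m) (e : RExpr m)
  /-- Execute `c` if `e < f`, and `d` otherwise. -/
  | ifLt (e f : RExpr m) (c d : Cmd k m)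
  /-- Flip a fresh coin: execute `c` with probability `e` (clamped to `[0, 1]`),
  and `d` otherwise. -/
  | coin (e : RExpr m) (c d : Cmd k m)

/-- A coin that shows `true` with probability `p`, clamped to `[0, 1]`. -/
def coinLaw (p : ℝ) : PMF Bool :=
  PMF.ofFintype
    (fun b => if b = true then min 1 (ENNReal.ofReal p) else 1 - min 1 (ENNReal.ofReal p))
    (by simp)

open Classical in
/-- The law of the memory after executing a command on the item `(i, j, v)`. -/
def Cmd.exec {k m : ℕ} (i j : ℕ) (v : ℝ) : Cmd k m → Mem k m → PMF (Mem k m)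
  | .skip, M => PMF.pure M
  | .seq c d, M => (c.exec i j v M).bind (d.exec i j v)
  | .readRow a, M => PMF.pure { M with idx := Function.update M.idx a i }
  | .readCol a, M => PMF.pure { M with idx := Function.update M.idx a j }
  | .readVal r, M => PMF.pure { M with val := Function.update M.val r v }
  | .copy a b, M => PMF.pure { M with idx := Function.update M.idx a (M.idx b) }
  | .set r e, M => PMF.pure { M with val := Function.update M.val r (e.eval M.val) }
  | .ifLt e f c d, M =>
      if e.eval M.val < f.eval M.val then c.exec i j v M else d.exec i j v M
  | .coin e c d, M =>
      (coinLaw (e.eval M.val)).bind fun b =>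
        if b = true then c.exec i j v M else d.exec i j v M

/-- A randomized one-pass program: code executed once on every stream item, and the list of
triples (row register, column register, value) that describes the output. -/
structure Program where
  k : ℕ
  m : ℕ
  body : Cmd k m
  out : List (Fin k × Fin k × RExpr m)

namespace Program

/-- The memory used, in registers. -/
def memory (P : Program) : ℕ := P.k + P.m

/-- The law of the memory after reading a stream once, from left to right. -/
def scan (P : Program) : List (ℕ × ℕ × ℝ) → Mem P.k P.m → PMF (Mem P.k P.m)
  | [], M => PMF.pure M
  | x :: l, M => (P.body.exec x.1 x.2.1 x.2.2 M).bind (P.scan l)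

/-- The `n × n` matrix described by the output triples (repeated positions add up). -/
def result (P : Program) (n : ℕ) (M : Mem P.k P.m) : Matrix (Fin n) (Fin n) ℝ :=
  Matrix.of fun i j =>
    (P.out.map fun o =>
      if M.idx o.1 = i ∧ M.idx o.2.1 = j then o.2.2.eval M.val else 0).sum

/-- The law of the output after one pass over the entries of `A`, which arrive in the order
of the positions in `l`; all registers are `0` at the start. -/
def run (P : Program) {n : ℕ} (A : Matrix (Fin n) (Fin n) ℝ) (l : List (Fin n × Fin n)) :
    PMF (Matrix (Fin n) (Fin n) ℝ) :=
  (P.scan (l.map fun x => ((x.1 : ℕ), (x.2 : ℕ), A x.1 x.2))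
    { idx := fun _ => 0, val := fun _ => 0 }).map (P.result n)

end Program

end Sparsify

end

/-!
Accuracy. Discarding the entries below `ε / (2 n)` changes the matrix by at most `ε / 2` in
Frobenius norm (`specNorm_sub_trunc_le`), so it remains to compare the truncated matrix `B` with
its sketch, an average of `s` independent samples `X` with mean `B`. This is a matrix Bernstein
inequality (`sum_prod_prob_le`), proved by the Ahlswede–Winter method: the Hermitian dilation `D`
turns the spectral norm into a largest eigenvalue, which is controlled by `trace (exp D)`
(`dotProduct_mulVec_le_of_trace_exp_lt`); the Golden–Thompson inequality (`trace_exp_add_le`) splits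
the samples off one at a time (`sum_prod_mul_trace_exp_le`), so that the expected trace
exponential is at most `2 n c ^ s`, where `c` bounds `E exp (θ D)` for a single centered sample.
Since `B` has no small non-zero entries, a centered sample has norm at most `4 n ‖B‖_F² / ε`, and its second
moment is at most `n ‖B‖_F²`; the exponential series then gives `c = 1 + 3 ε² / (40 n ‖B‖_F²)`
(`sum_prob_mul_exp_dilation_le`), and Markov's inequality concludes.

The Golden–Thompson inequality follows from the Lie–Trotter formula (`tendsto_exp_mul_exp_pow`) and
from `trace ((p q) ^ N) ≤ trace (p ^ N q ^ N)` for symmetric `p`, `q` and `N` a power of two, which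
only needs the inequality `2 trace (x y) ≤ trace (x xᵀ) + trace (y yᵀ)`.

Streaming. The program is weighted reservoir sampling with `s` independent reservoirs. It keeps the
running total `W` of the squares of the retained entries; a new entry `b` replaces the content of
each reservoir with probability `b² / (W + b²)`, `W` being the total before `b`. This keeps the law
of each reservoir proportional to the squares (`IsReservoirLaw.of_cons_ne_zero`), whatever the order
of arrival, and the final total `W = ‖B‖_F²` is what is needed to rescale the samples.
-/

namespace Sparsify

open Matrix Filter Topology
open scoped Nat

/-! ### The Lie–Trotter product formula -/

theorem norm_exp_le {𝔸 : Type*} [NormedRing 𝔸] [NormedAlgebra ℝ 𝔸] [NormOneClass 𝔸]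
    [CompleteSpace 𝔸] (x : 𝔸) : ‖NormedSpace.exp x‖ ≤ Real.exp ‖x‖ := by
  have h1 := NormedSpace.exp_series_hasSum_exp' (𝕂 := ℝ) x
  have h2 := NormedSpace.exp_series_hasSum_exp' (𝕂 := ℝ) ‖x‖
  rw [← Real.exp_eq_exp_ℝ] at h2
  refine h1.norm_le_of_bounded h2 fun n => ?_
  rw [norm_smul, Real.norm_of_nonneg (by positivity), smul_eq_mul]
  gcongr
  exact norm_pow_le x n

theorem norm_pow_sub_pow_le {𝔸 : Type*} [NormedRing 𝔸] [NormOneClass 𝔸] {x y : 𝔸} {c : ℝ}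
    (hc : 1 ≤ c) (hx : ‖x‖ ≤ c) (hy : ‖y‖ ≤ c) (k : ℕ) :
    ‖x ^ k - y ^ k‖ ≤ k * c ^ k * ‖x - y‖ := by
  induction k with
  | zero => simp
  | succ k ih =>
    have h0 : x ^ (k + 1) - y ^ (k + 1) = x * (x ^ k - y ^ k) + (x - y) * y ^ k := by
      rw [pow_succ' x, pow_succ' y]; noncomm_ring
    have hyk : ‖y ^ k‖ ≤ c ^ (k + 1) :=
      (norm_pow_le y k).trans <| (pow_le_pow_left₀ (norm_nonneg _) hy k).trans <|
        pow_le_pow_right₀ hc (Nat.le_succ k)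
    calc ‖x ^ (k + 1) - y ^ (k + 1)‖
        ≤ ‖x‖ * ‖x ^ k - y ^ k‖ + ‖x - y‖ * ‖y ^ k‖ := by
          rw [h0]
          exact (norm_add_le _ _).trans (add_le_add (norm_mul_le _ _) (norm_mul_le _ _))
      _ ≤ c * (k * c ^ k * ‖x - y‖) + ‖x - y‖ * c ^ (k + 1) := by gcongr
      _ = ((k + 1 : ℕ) : ℝ) * c ^ (k + 1) * ‖x - y‖ := by push_cast; ring

/-- The **Lie–Trotter product formula**, along the exponents `2 ^ k`. -/
theorem tendsto_exp_mul_exp_pow {𝔸 : Type*} [NormedRing 𝔸] [NormedAlgebra ℝ 𝔸]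
    [NormOneClass 𝔸] [CompleteSpace 𝔸] (a b : 𝔸) :
    Tendsto (fun k : ℕ => (NormedSpace.exp (((2 : ℝ) ^ k)⁻¹ • a) *
      NormedSpace.exp (((2 : ℝ) ^ k)⁻¹ • b)) ^ 2 ^ k) atTop (𝓝 (NormedSpace.exp (a + b))) := by
  -- the two curves `exp (t a) exp (t b)` and `exp (t (a + b))` agree to first order at `t = 0`
  have hd : HasDerivAt (fun t : ℝ => NormedSpace.exp (t • a) * NormedSpace.exp (t • b) -
      NormedSpace.exp (t • (a + b))) 0 0 := by
    have h := ((hasDerivAt_exp_smul_const (𝕂 := ℝ) a 0).mul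
      (hasDerivAt_exp_smul_const (𝕂 := ℝ) b 0)).sub
      (hasDerivAt_exp_smul_const (𝕂 := ℝ) (a + b) 0)
    exact h.congr_deriv (by simp [NormedSpace.exp_zero])
  have hu : Tendsto (fun k : ℕ => ((2 : ℝ) ^ k)⁻¹) atTop (𝓝[≠] 0) := by
    refine tendsto_nhdsWithin_iff.2 ⟨?_, Eventually.of_forall fun k => ?_⟩
    · exact tendsto_inv_atTop_zero.comp (tendsto_pow_atTop_atTop_of_one_lt one_lt_two)
    · simp
  have hlim := ((hasDerivAt_iff_tendsto_slope.1 hd).comp hu).norm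
  rw [norm_zero] at hlim
  rw [tendsto_iff_norm_sub_tendsto_zero]
  have hlim' := hlim.const_mul (Real.exp (‖a‖ + ‖b‖))
  rw [mul_zero] at hlim'
  refine squeeze_zero (fun _ => norm_nonneg _) (fun k => ?_) hlim'
  set u : ℝ := ((2 : ℝ) ^ k)⁻¹ with hu_def
  have hu0 : 0 < u := by positivity
  have hku : ((2 ^ k : ℕ) : ℝ) * u = 1 := by
    rw [hu_def]; push_cast; exact mul_inv_cancel₀ (by positivity)
  have hns : ∀ x : 𝔸, ‖u • x‖ = u * ‖x‖ := fun x => by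
    rw [norm_smul, Real.norm_of_nonneg hu0.le]
  have hx : ‖NormedSpace.exp (u • a) * NormedSpace.exp (u • b)‖ ≤
      Real.exp (u * (‖a‖ + ‖b‖)) := by
    refine (norm_mul_le _ _).trans ?_
    rw [mul_add, Real.exp_add, ← hns, ← hns]
    gcongr <;> exact norm_exp_le _
  have hy : ‖NormedSpace.exp (u • (a + b))‖ ≤ Real.exp (u * (‖a‖ + ‖b‖)) := by
    refine (norm_exp_le _).trans (Real.exp_le_exp.2 ?_)
    rw [hns]
    gcongr
    exact norm_add_le a b
  have hc : 1 ≤ Real.exp (u * (‖a‖ + ‖b‖)) := Real.one_le_exp (by positivity)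
  have he : NormedSpace.exp (a + b) = NormedSpace.exp (u • (a + b)) ^ 2 ^ k := by
    let : NormedAlgebra ℚ 𝔸 := NormedAlgebra.restrictScalars ℚ ℝ 𝔸
    rw [← NormedSpace.exp_nsmul, ← Nat.cast_smul_eq_nsmul ℝ, smul_smul, hku, one_smul]
  have hmain := norm_pow_sub_pow_le hc hx hy (2 ^ k)
  rw [he]
  refine hmain.trans (le_of_eq ?_)
  rw [← Real.exp_nat_mul, ← mul_assoc, hku, one_mul]
  simp only [Function.comp, slope_def_module, zero_smul, sub_zero, NormedSpace.exp_zero, mul_one,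
    sub_self]
  rw [norm_smul, norm_inv, Real.norm_of_nonneg hu0.le]
  have : u⁻¹ = ((2 ^ k : ℕ) : ℝ) := by rw [hu_def, inv_inv]; push_cast; rfl
  rw [this]; ring

/-! ### The Golden–Thompson inequality -/

theorem two_mul_trace_mul_le {m : Type*} [Fintype m] (x y : Matrix m m ℝ) :
    2 * trace (x * y) ≤ trace (x * xᵀ) + trace (y * yᵀ) := by
  have h : 0 ≤ trace ((x - yᵀ) * (x - yᵀ)ᵀ) := by
    simp only [trace, diag, mul_apply, transpose_apply]
    exact Finset.sum_nonneg fun i _ => Finset.sum_nonneg fun j _ => mul_self_nonneg _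
  have h2 : trace (yᵀ * xᵀ) = trace (x * y) := by
    rw [← transpose_mul, trace_transpose]
  rw [transpose_sub, transpose_transpose, sub_mul, mul_sub, mul_sub, trace_sub, trace_sub,
    trace_sub, h2, trace_mul_comm yᵀ y] at h
  linarith

section GoldenThompson

variable {m : Type*} [Fintype m] [DecidableEq m]

theorem trace_mul_pow_comm (x y : Matrix m m ℝ) (k : ℕ) :
    trace ((x * y) ^ k) = trace ((y * x) ^ k) := by
  cases k with
  | zero => simp
  | succ k =>
    have h : (x * y) ^ k * x = x * (y * x) ^ k := by
      have : SemiconjBy x (y * x) (x * y) := by simp [SemiconjBy, mul_assoc]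
      exact (this.pow_right k).eq.symm
    rw [pow_succ, ← mul_assoc, h, mul_assoc, trace_mul_comm, mul_assoc, ← pow_succ]

/-- The trace inequalities behind the Golden–Thompson inequality. Both are proved by one
induction: each step of either uses the previous instances of both. -/
theorem trace_pow_two_pow_le (k : ℕ) :
    (∀ x : Matrix m m ℝ, trace (x ^ 2 ^ (k + 1)) ≤ trace ((x * xᵀ) ^ 2 ^ k)) ∧
    ∀ p q : Matrix m m ℝ, p.IsSymm → q.IsSymm →
      trace ((p * q) ^ 2 ^ k) ≤ trace (p ^ 2 ^ k * q ^ 2 ^ k) := by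
  induction k with
  | zero =>
    refine ⟨fun x => ?_, fun p q _ _ => by simp⟩
    have := two_mul_trace_mul_le x x
    simp only [zero_add, pow_one, pow_zero, pow_two]
    linarith
  | succ k ih =>
    obtain ⟨iha, ihb⟩ := ih
    have hpow : ∀ (x : Matrix m m ℝ) (j : ℕ), x ^ 2 ^ (j + 1) = (x * x) ^ 2 ^ j := fun x j => by
      rw [pow_succ' 2 j, pow_mul, pow_two]
    refine ⟨fun x => ?_, fun p q hp hq => ?_⟩
    · have hs : (x * xᵀ).IsSymm := isSymm_mul_transpose_self x
      have ht : (xᵀ * x).IsSymm := isSymm_transpose_mul_self x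
      have h1 : trace (x ^ 2 ^ (k + 1 + 1)) ≤ trace ((x * xᵀ) ^ 2 ^ k * (xᵀ * x) ^ 2 ^ k) := by
        rw [hpow]
        refine (iha (x * x)).trans ?_
        rw [transpose_mul, mul_assoc, trace_mul_pow_comm, ← mul_assoc x, mul_assoc (x * xᵀ)]
        exact ihb _ _ hs ht
      have h2 := two_mul_trace_mul_le ((x * xᵀ) ^ 2 ^ k) ((xᵀ * x) ^ 2 ^ k)
      rw [(hs.pow _).eq, (ht.pow _).eq, ← pow_add, ← pow_add, ← two_mul, ← pow_succ',
        trace_mul_pow_comm xᵀ x] at h2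
      linarith
    · rw [hpow p, hpow q]
      refine (iha (p * q)).trans ?_
      have h1 : trace ((p * q * (p * q)ᵀ) ^ 2 ^ k) = trace ((p * p * (q * q)) ^ 2 ^ k) := by
        rw [transpose_mul, hp.eq, hq.eq, mul_assoc, trace_mul_pow_comm, ← mul_assoc,
          mul_assoc (q * q), trace_mul_pow_comm]
      rw [h1]
      refine ihb _ _ ?_ ?_
      · simpa [pow_two] using hp.pow 2
      · simpa [pow_two] using hq.pow 2

open scoped Matrix.Norms.L2Operator in
/-- The **Golden–Thompson inequality** for real symmetric matrices. -/
theorem trace_exp_add_le {a b : Matrix m m ℝ} (ha : a.IsSymm) (hb : b.IsSymm) :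
    trace (NormedSpace.exp (a + b)) ≤ trace (NormedSpace.exp a * NormedSpace.exp b) := by
  cases isEmpty_or_nonempty m
  · simp [trace]
  have hlim := (continuous_id.matrix_trace.tendsto _).comp (tendsto_exp_mul_exp_pow a b)
  refine le_of_tendsto hlim (Eventually.of_forall fun k => ?_)
  have he : ∀ x : Matrix m m ℝ, NormedSpace.exp (((2 : ℝ) ^ k)⁻¹ • x) ^ 2 ^ k =
      NormedSpace.exp x := fun x => by
    rw [← Matrix.exp_nsmul, ← Nat.cast_smul_eq_nsmul ℝ, smul_smul]
    push_cast
    rw [mul_inv_cancel₀ (by positivity), one_smul]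
  have h := (trace_pow_two_pow_le k).2 _ _ (ha.smul ((2 : ℝ) ^ k)⁻¹).exp
    (hb.smul ((2 : ℝ) ^ k)⁻¹).exp
  rwa [he, he] at h

end GoldenThompson

/-! ### Traces of exponentials of random symmetric matrices -/

theorem zero_le_dotProduct_self {m : Type*} [Fintype m] (v : m → ℝ) : 0 ≤ v ⬝ᵥ v :=
  Finset.sum_nonneg fun i _ => mul_self_nonneg (v i)

theorem dotProduct_sq_le {m : Type*} [Fintype m] (v w : m → ℝ) :
    (v ⬝ᵥ w) ^ 2 ≤ (v ⬝ᵥ v) * (w ⬝ᵥ w) := by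
  have h := Finset.sum_mul_sq_le_sq_mul_sq Finset.univ v w
  simpa only [dotProduct, ← pow_two] using h

theorem two_mul_three_pow_le_factorial (k : ℕ) : 2 * 3 ^ k ≤ (k + 2)! := by
  induction k with
  | zero => rfl
  | succ k ih =>
    rw [show k + 1 + 2 = (k + 2) + 1 from rfl, Nat.factorial_succ, pow_succ]
    nlinarith

theorem isSymm_sum {m ι : Type*} {f : ι → Matrix m m ℝ} (hf : ∀ i, (f i).IsSymm) (u : Finset ι) :
    (∑ i ∈ u, f i).IsSymm := by
  rw [IsSymm, transpose_sum]
  exact Finset.sum_congr rfl fun i _ => (hf i).eq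

section TraceExp

variable {m : Type*} [Fintype m] [DecidableEq m]

theorem dotProduct_pow_mulVec_le {h : Matrix m m ℝ} {r : ℝ} (hr : 0 ≤ r)
    (hb : ∀ v, h *ᵥ v ⬝ᵥ h *ᵥ v ≤ r ^ 2 * (v ⬝ᵥ v)) (k : ℕ) (w : m → ℝ) :
    w ⬝ᵥ (h ^ k) *ᵥ w ≤ r ^ k * (w ⬝ᵥ w) := by
  have hk : (h ^ k) *ᵥ w ⬝ᵥ (h ^ k) *ᵥ w ≤ (r ^ k) ^ 2 * (w ⬝ᵥ w) := by
    induction k with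
    | zero => simp
    | succ k ih =>
      rw [pow_succ', ← mulVec_mulVec]
      refine (hb _).trans ?_
      calc r ^ 2 * (h ^ k *ᵥ w ⬝ᵥ h ^ k *ᵥ w) ≤ r ^ 2 * ((r ^ k) ^ 2 * (w ⬝ᵥ w)) := by gcongr
        _ = _ := by ring
  have hw := zero_le_dotProduct_self w
  refine le_of_sq_le_sq ?_ (by positivity)
  calc (w ⬝ᵥ (h ^ k) *ᵥ w) ^ 2 ≤ (w ⬝ᵥ w) * ((h ^ k) *ᵥ w ⬝ᵥ (h ^ k) *ᵥ w) := dotProduct_sq_le _ _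
    _ ≤ (w ⬝ᵥ w) * ((r ^ k) ^ 2 * (w ⬝ᵥ w)) := by gcongr
    _ = _ := by ring

open scoped Matrix.Norms.L2Operator in
/-- The quadratic-form version of `exp x ≤ 1 + x + (5 / 6) x ^ 2` for `|x| ≤ 6 / 5`: from the
second-order term on, the exponential series is dominated by a geometric series of ratio `2 / 5`,
because `2 * 3 ^ k ≤ (k + 2)!`. -/
theorem dotProduct_exp_mulVec_le {h : Matrix m m ℝ} (hs : h.IsSymm)
    (hb : ∀ v, h *ᵥ v ⬝ᵥ h *ᵥ v ≤ (6 / 5) ^ 2 * (v ⬝ᵥ v)) (v : m → ℝ) :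
    v ⬝ᵥ NormedSpace.exp h *ᵥ v ≤ v ⬝ᵥ v + v ⬝ᵥ h *ᵥ v + 5 / 6 * (h *ᵥ v ⬝ᵥ h *ᵥ v) := by
  let g : Matrix m m ℝ →+ ℝ := AddMonoidHom.mk' (fun x => v ⬝ᵥ x *ᵥ v) fun x y => by
    rw [add_mulVec, dotProduct_add]
  have hg : Continuous g := by
    change Continuous fun x : Matrix m m ℝ => v ⬝ᵥ x *ᵥ v
    exact continuous_const.dotProduct (continuous_id.matrix_mulVec continuous_const)
  have h1 := (NormedSpace.exp_series_hasSum_exp' (𝕂 := ℝ) h).map g hg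
  rw [← hasSum_nat_add_iff' 2] at h1
  set q := h *ᵥ v ⬝ᵥ h *ᵥ v with hq
  have hq0 : 0 ≤ q := zero_le_dotProduct_self _
  have h2 : HasSum (fun k : ℕ => q / 2 * (2 / 5) ^ k) (q / 2 * (1 - 2 / 5)⁻¹) :=
    (hasSum_geometric_of_lt_one (by norm_num) (by norm_num)).mul_left _
  have h3 := hasSum_le (fun k => ?_) h1 h2
  · simp only [Finset.sum_range_succ, Finset.sum_range_zero, Function.comp_apply, zero_add, g,
      AddMonoidHom.mk'_apply, Nat.factorial_zero, Nat.factorial_one, pow_zero, pow_one,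
      Nat.cast_one, inv_one, one_smul, one_mulVec] at h3
    linarith
  · simp only [Function.comp_apply, g, AddMonoidHom.mk'_apply, smul_mulVec, dotProduct_smul,
      smul_eq_mul]
    have h4 : v ⬝ᵥ (h ^ (k + 2)) *ᵥ v = h *ᵥ v ⬝ᵥ (h ^ k) *ᵥ (h *ᵥ v) := by
      rw [pow_succ', ← mulVec_mulVec, dotProduct_mulVec, ← mulVec_transpose, hs.eq, pow_succ,
        ← mulVec_mulVec]
    have h5 := dotProduct_pow_mulVec_le (by norm_num) hb k (h *ᵥ v)
    have h6 : (2 * 3 ^ k : ℝ) ≤ ((k + 2)! : ℝ) := by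
      exact_mod_cast two_mul_three_pow_le_factorial k
    rw [h4]
    calc ((k + 2)! : ℝ)⁻¹ * (h *ᵥ v ⬝ᵥ (h ^ k) *ᵥ (h *ᵥ v))
        ≤ ((k + 2)! : ℝ)⁻¹ * ((6 / 5) ^ k * q) := by gcongr
      _ ≤ (2 * 3 ^ k : ℝ)⁻¹ * ((6 / 5) ^ k * q) := by gcongr
      _ = q / 2 * (2 / 5) ^ k := by
        rw [show (2 / 5 : ℝ) = 6 / 5 / 3 by norm_num, div_pow (6 / 5 : ℝ)]
        field_simp

theorem exp_eq_half_mul_transpose {x : Matrix m m ℝ} (hx : x.IsSymm) :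
    NormedSpace.exp x =
      NormedSpace.exp ((1 / 2 : ℝ) • x) * (NormedSpace.exp ((1 / 2 : ℝ) • x))ᵀ := by
  rw [(hx.smul (1 / 2 : ℝ)).exp.eq, ← Matrix.exp_add_of_commute _ _ (Commute.refl _), ← add_smul]
  norm_num

theorem trace_mul_exp_le {e x : Matrix m m ℝ} (hx : x.IsSymm) {c : ℝ}
    (he : ∀ v, v ⬝ᵥ e *ᵥ v ≤ c * (v ⬝ᵥ v)) :
    trace (e * NormedSpace.exp x) ≤ c * trace (NormedSpace.exp x) := by
  rw [exp_eq_half_mul_transpose hx]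
  set g := NormedSpace.exp ((1 / 2 : ℝ) • x)
  rw [← mul_assoc, trace_mul_comm, ← mul_assoc]
  have hgt : gᵀ = g := (hx.smul (1 / 2 : ℝ)).exp.eq
  simp only [trace, Finset.mul_sum, diag]
  refine Finset.sum_le_sum fun i _ => ?_
  have h1 : (gᵀ * e * g) i i = g i ⬝ᵥ e *ᵥ g i := by
    rw [hgt, mul_assoc]
    nth_rewrite 2 [← hgt]
    rfl
  rw [h1]
  exact he (g i)

theorem trace_exp_nonneg {x : Matrix m m ℝ} (hx : x.IsSymm) : 0 ≤ trace (NormedSpace.exp x) := by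
  rw [exp_eq_half_mul_transpose hx]
  simp only [trace, diag, mul_apply, transpose_apply]
  exact Finset.sum_nonneg fun i _ => Finset.sum_nonneg fun j _ => mul_self_nonneg _

/-- The expected trace exponential of a sum of `s` independent symmetric random matrices with
common law `w`, if `E exp (h a) ≤ c` as quadratic forms. The Golden–Thompson inequality splits
off one summand at a time. -/
theorem sum_prod_mul_trace_exp_le {α : Type*} [Fintype α] {w : α → ℝ} (hw : ∀ a, 0 ≤ w a)
    {h : α → Matrix m m ℝ} (hh : ∀ a, (h a).IsSymm) {c : ℝ} (hc : 0 ≤ c)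
    (he : ∀ v, ∑ a, w a * (v ⬝ᵥ NormedSpace.exp (h a) *ᵥ v) ≤ c * (v ⬝ᵥ v)) (s : ℕ) :
    ∑ x : Fin s → α, (∏ t, w (x t)) * trace (NormedSpace.exp (∑ t, h (x t))) ≤
      c ^ s * Fintype.card m := by
  induction s with
  | zero => simp [trace]
  | succ s ih =>
    have hE : ∀ v, v ⬝ᵥ (∑ a, w a • NormedSpace.exp (h a)) *ᵥ v ≤ c * (v ⬝ᵥ v) := fun v => by
      refine le_of_eq_of_le ?_ (he v)
      rw [sum_mulVec, dotProduct_sum]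
      simp only [smul_mulVec, dotProduct_smul, smul_eq_mul]
    calc ∑ x : Fin (s + 1) → α, (∏ t, w (x t)) * trace (NormedSpace.exp (∑ t, h (x t)))
        = ∑ a, ∑ x : Fin s → α, (w a * ∏ t, w (x t)) *
            trace (NormedSpace.exp (h a + ∑ t, h (x t))) := by
          rw [← (Fin.consEquiv fun _ => α).sum_comp, Fintype.sum_prod_type]
          simp [Fin.prod_univ_succ, Fin.sum_univ_succ]
      _ ≤ ∑ a, ∑ x : Fin s → α, (w a * ∏ t, w (x t)) *
            trace (NormedSpace.exp (h a) * NormedSpace.exp (∑ t, h (x t))) := by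
          gcongr with a _ x _
          · exact mul_nonneg (hw a) (Finset.prod_nonneg fun t _ => hw _)
          · exact trace_exp_add_le (hh a) (isSymm_sum (fun t => hh (x t)) _)
      _ = ∑ x : Fin s → α, (∏ t, w (x t)) *
            trace ((∑ a, w a • NormedSpace.exp (h a)) * NormedSpace.exp (∑ t, h (x t))) := by
          rw [Finset.sum_comm]
          refine Finset.sum_congr rfl fun x _ => ?_
          rw [Finset.sum_mul, trace_sum, Finset.mul_sum]
          refine Finset.sum_congr rfl fun a _ => ?_
          rw [smul_mul_assoc, trace_smul, smul_eq_mul]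
          ring
      _ ≤ ∑ x : Fin s → α, (∏ t, w (x t)) *
            (c * trace (NormedSpace.exp (∑ t, h (x t)))) := by
          gcongr with x _
          · exact Finset.prod_nonneg fun t _ => hw _
          · exact trace_mul_exp_le (isSymm_sum (fun t => hh (x t)) _) hE
      _ = c * ∑ x : Fin s → α, (∏ t, w (x t)) * trace (NormedSpace.exp (∑ t, h (x t))) := by
          rw [Finset.mul_sum]
          exact Finset.sum_congr rfl fun x _ => by ring
      _ ≤ c * (c ^ s * Fintype.card m) := by gcongr
      _ = c ^ (s + 1) * Fintype.card m := by ring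

/-- The trace exponential of a symmetric matrix bounds its largest eigenvalue. -/
theorem dotProduct_mulVec_le_of_trace_exp_lt {d : Matrix m m ℝ} (hd : d.IsSymm) {τ : ℝ}
    (ht : trace (NormedSpace.exp d) < Real.exp τ) (v : m → ℝ) :
    v ⬝ᵥ d *ᵥ v ≤ τ * (v ⬝ᵥ v) := by
  have hH : d.IsHermitian := by rw [IsHermitian, conjTranspose_eq_transpose_of_trivial, hd.eq]
  set u : Matrix m m ℝ := (hH.eigenvectorUnitary : Matrix m m ℝ) with hu
  set l := hH.eigenvalues with hl
  have huu : uᵀ * u = 1 := by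
    have := Unitary.coe_star_mul_self hH.eigenvectorUnitary
    rwa [star_eq_conjTranspose, conjTranspose_eq_transpose_of_trivial] at this
  have huu' : u * uᵀ = 1 := mul_eq_one_comm.1 huu
  have hspec : d = u * diagonal l * uᵀ := by
    have := hH.spectral_theorem
    rwa [Unitary.conjStarAlgAut_apply, star_eq_conjTranspose,
      conjTranspose_eq_transpose_of_trivial] at this
  have hinv : u⁻¹ = uᵀ := inv_eq_right_inv huu'
  have hexp : trace (NormedSpace.exp d) = ∑ i, Real.exp (l i) := by
    have h1 := Matrix.exp_conj u (diagonal l) (IsUnit.of_mul_eq_one _ huu')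
    rw [hinv, ← hspec] at h1
    rw [h1, trace_mul_comm, ← mul_assoc, huu, one_mul, Matrix.exp_diagonal, trace_diagonal]
    refine Finset.sum_congr rfl fun i _ => ?_
    rw [Pi.coe_exp, Real.exp_eq_exp_ℝ]
  have hli : ∀ i, l i ≤ τ := fun i => by
    refine Real.exp_le_exp.1 (le_trans ?_ ht.le)
    rw [hexp]
    exact Finset.single_le_sum (f := fun i => Real.exp (l i)) (fun j _ => (Real.exp_pos _).le)
      (Finset.mem_univ i)
  have h1 : v ⬝ᵥ d *ᵥ v = ∑ i, l i * (uᵀ *ᵥ v) i ^ 2 := by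
    rw [hspec, ← mulVec_mulVec, ← mulVec_mulVec, dotProduct_mulVec, ← mulVec_transpose]
    simp only [dotProduct, mulVec_diagonal]
    exact Finset.sum_congr rfl fun i _ => by ring
  have h2 : v ⬝ᵥ v = ∑ i, (uᵀ *ᵥ v) i ^ 2 := by
    have : v ⬝ᵥ v = uᵀ *ᵥ v ⬝ᵥ uᵀ *ᵥ v := by
      rw [dotProduct_mulVec, ← mulVec_transpose, transpose_transpose, mulVec_mulVec, huu',
        one_mulVec]
    rw [this]
    simp only [dotProduct, pow_two]
  rw [h1, h2, Finset.mul_sum]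
  gcongr with i
  exact hli i

end TraceExp

/-! ### Hermitian dilation -/

/-- The Hermitian dilation of a square matrix: a symmetric matrix of twice the size whose
largest eigenvalue is the spectral norm. -/
def dilation {n : ℕ} : Matrix (Fin n) (Fin n) ℝ →ₗ[ℝ] Matrix (Fin n ⊕ Fin n) (Fin n ⊕ Fin n) ℝ where
  toFun M := fromBlocks 0 M Mᵀ 0
  map_add' M N := by simp [fromBlocks_add]
  map_smul' c M := by simp [fromBlocks_smul]

theorem dilation_apply {n : ℕ} (M : Matrix (Fin n) (Fin n) ℝ) :
    dilation M = fromBlocks 0 M Mᵀ 0 := rfl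

theorem dilation_isSymm {n : ℕ} (M : Matrix (Fin n) (Fin n) ℝ) : (dilation M).IsSymm := by
  simp [dilation_apply, IsSymm, fromBlocks_transpose]

theorem dilation_mulVec {n : ℕ} (M : Matrix (Fin n) (Fin n) ℝ) (u w : Fin n → ℝ) :
    dilation M *ᵥ Sum.elim u w = Sum.elim (M *ᵥ w) (Mᵀ *ᵥ u) := by
  simp [dilation_apply, fromBlocks_mulVec]

theorem specNorm_le_iff {n : ℕ} {M : Matrix (Fin n) (Fin n) ℝ} {τ : ℝ} (hτ : 0 ≤ τ) :
    specNorm M ≤ τ ↔ ∀ w, M *ᵥ w ⬝ᵥ M *ᵥ w ≤ τ ^ 2 * (w ⬝ᵥ w) := by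
  have hn : ∀ x : EuclideanSpace ℝ (Fin n), ‖x‖ ^ 2 = x.ofLp ⬝ᵥ x.ofLp := fun x => by
    rw [EuclideanSpace.norm_sq_eq]; simp [dotProduct, pow_two]
  have hkey : ∀ x : EuclideanSpace ℝ (Fin n),
      ‖toEuclideanCLM (n := Fin n) (𝕜 := ℝ) M x‖ ≤ τ * ‖x‖ ↔
        M *ᵥ x.ofLp ⬝ᵥ M *ᵥ x.ofLp ≤ τ ^ 2 * (x.ofLp ⬝ᵥ x.ofLp) := fun x => by
    rw [← pow_le_pow_iff_left₀ (norm_nonneg _) (by positivity) two_ne_zero, mul_pow, hn, hn,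
      ofLp_toEuclideanCLM]
  rw [specNorm, ContinuousLinearMap.opNorm_le_iff hτ]
  exact ⟨fun h w => (hkey (WithLp.toLp 2 w)).1 (h _), fun h x => (hkey x).2 (h _)⟩

theorem specNorm_le_of_dilation {n : ℕ} {M : Matrix (Fin n) (Fin n) ℝ} {τ : ℝ} (hτ : 0 < τ)
    (h : ∀ v, v ⬝ᵥ dilation M *ᵥ v ≤ τ * (v ⬝ᵥ v)) : specNorm M ≤ τ := by
  refine (specNorm_le_iff hτ.le).2 fun w => ?_
  -- the test vector `(M w, τ w)` turns the bound on the form into a bound on `M w`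
  have h1 := h (Sum.elim (M *ᵥ w) (τ • w))
  have h2 : w ⬝ᵥ Mᵀ *ᵥ (M *ᵥ w) = M *ᵥ w ⬝ᵥ M *ᵥ w := by
    rw [dotProduct_mulVec, vecMul_transpose]
  rw [dilation_mulVec, sumElim_dotProduct_sumElim, sumElim_dotProduct_sumElim, mulVec_smul,
    dotProduct_smul, smul_dotProduct, smul_dotProduct, dotProduct_smul, h2] at h1
  simp only [smul_eq_mul] at h1
  have h3 : τ * (M *ᵥ w ⬝ᵥ M *ᵥ w) ≤ τ * (τ ^ 2 * (w ⬝ᵥ w)) := by linarith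
  exact le_of_mul_le_mul_left h3 hτ

/-! ### Moments of one sample -/

/-- The contribution `(B i j / p i j) e_i e_jᵀ` of the sampled position `a = (i, j)`. It is `0`
where `B` vanishes. -/
noncomputable def rankOne {n : ℕ} (B : Matrix (Fin n) (Fin n) ℝ) (a : Fin n × Fin n) :
    Matrix (Fin n) (Fin n) ℝ :=
  Matrix.single a.1 a.2 (B a.1 a.2 / prob B a)

section Moments

variable {n : ℕ} {B : Matrix (Fin n) (Fin n) ℝ}

theorem frobSq_pos (hB : B ≠ 0) : 0 < frobSq B :=
  (frobSq_nonneg B).lt_of_ne (frobSq_ne_zero hB).symm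

theorem frobSq_eq_sum (B : Matrix (Fin n) (Fin n) ℝ) :
    frobSq B = ∑ a : Fin n × Fin n, B a.1 a.2 ^ 2 :=
  (Fintype.sum_prod_type fun a : Fin n × Fin n => B a.1 a.2 ^ 2).symm

theorem frobSq_transpose (B : Matrix (Fin n) (Fin n) ℝ) : frobSq Bᵀ = frobSq B :=
  Finset.sum_comm

theorem prob_nonneg (B : Matrix (Fin n) (Fin n) ℝ) (a : Fin n × Fin n) : 0 ≤ prob B a :=
  div_nonneg (sq_nonneg _) (frobSq_nonneg B)

theorem sum_prob_eq_one (hB : B ≠ 0) : ∑ a, prob B a = 1 := by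
  simp only [prob]
  rw [← Finset.sum_div, ← frobSq_eq_sum, div_self (frobSq_ne_zero hB)]

theorem prob_transpose (a : Fin n × Fin n) : prob Bᵀ a.swap = prob B a := by
  simp [prob, frobSq_transpose]

theorem rankOne_transpose (a : Fin n × Fin n) : rankOne Bᵀ a.swap = (rankOne B a)ᵀ := by
  simp [rankOne, prob_transpose]

theorem prob_mul_div (hB : B ≠ 0) (a : Fin n × Fin n) :
    prob B a * (B a.1 a.2 / prob B a) = B a.1 a.2 := by
  by_cases h : B a.1 a.2 = 0
  · simp [h]
  · have : prob B a ≠ 0 := div_ne_zero (pow_ne_zero 2 h) (frobSq_ne_zero hB)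
    field_simp

theorem prob_mul_div_sq_le (a : Fin n × Fin n) :
    prob B a * (B a.1 a.2 / prob B a) ^ 2 ≤ frobSq B := by
  by_cases h : B a.1 a.2 = 0
  · simpa [h] using frobSq_nonneg B
  · have hF : frobSq B ≠ 0 := frobSq_ne_zero fun h0 => h (by simp [h0])
    refine le_of_eq ?_
    rw [prob]
    field_simp

theorem sum_prob_smul_rankOne (hB : B ≠ 0) : ∑ a, prob B a • rankOne B a = B := by
  simp only [rankOne, smul_single, smul_eq_mul, prob_mul_div hB, Fintype.sum_prod_type]
  exact (matrix_eq_sum_single B).symm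

theorem rankOne_mulVec_sq (a : Fin n × Fin n) (w : Fin n → ℝ) :
    rankOne B a *ᵥ w ⬝ᵥ rankOne B a *ᵥ w = (B a.1 a.2 / prob B a) ^ 2 * w a.2 ^ 2 := by
  rw [rankOne, single_mulVec, ← Pi.single, dotProduct_single, Pi.single_eq_same]
  ring

/-- The second moment `E ‖(B - X) w‖²` of the centered sample: centering only decreases
`E ‖X w‖²`, in which every position contributes at most `‖B‖_F² w_j²`. -/
theorem sum_prob_mul_sub_sq_le (hB : B ≠ 0) (w : Fin n → ℝ) :
    ∑ a, prob B a * ((B - rankOne B a) *ᵥ w ⬝ᵥ (B - rankOne B a) *ᵥ w) ≤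
      n * frobSq B * (w ⬝ᵥ w) := by
  have h1 : ∑ a, prob B a * (rankOne B a *ᵥ w ⬝ᵥ B *ᵥ w) = B *ᵥ w ⬝ᵥ B *ᵥ w := by
    conv_rhs => enter [1, 1]; rw [← sum_prob_smul_rankOne hB]
    rw [sum_mulVec, sum_dotProduct]
    simp only [smul_mulVec, smul_dotProduct, smul_eq_mul]
  have h2 : ∑ a, prob B a * (rankOne B a *ᵥ w ⬝ᵥ rankOne B a *ᵥ w) ≤
      n * frobSq B * (w ⬝ᵥ w) := by
    calc ∑ a, prob B a * (rankOne B a *ᵥ w ⬝ᵥ rankOne B a *ᵥ w)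
        ≤ ∑ a : Fin n × Fin n, frobSq B * w a.2 ^ 2 := by
          refine Finset.sum_le_sum fun a _ => ?_
          rw [rankOne_mulVec_sq, ← mul_assoc]
          exact mul_le_mul_of_nonneg_right (prob_mul_div_sq_le a) (sq_nonneg _)
      _ = n * frobSq B * (w ⬝ᵥ w) := by
          rw [Fintype.sum_prod_type]
          simp [dotProduct, Finset.mul_sum, pow_two, mul_assoc]
  have h3 : ∀ a, prob B a * ((B - rankOne B a) *ᵥ w ⬝ᵥ (B - rankOne B a) *ᵥ w) =
      prob B a * (rankOne B a *ᵥ w ⬝ᵥ rankOne B a *ᵥ w) -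
        2 * (prob B a * (rankOne B a *ᵥ w ⬝ᵥ B *ᵥ w)) + prob B a * (B *ᵥ w ⬝ᵥ B *ᵥ w) := fun a => by
    rw [sub_mulVec, dotProduct_sub, sub_dotProduct, sub_dotProduct,
      dotProduct_comm (B *ᵥ w) (rankOne B a *ᵥ w)]
    ring
  rw [Finset.sum_congr rfl fun a _ => h3 a, Finset.sum_add_distrib, Finset.sum_sub_distrib,
    ← Finset.mul_sum, h1, ← Finset.sum_mul, sum_prob_eq_one hB]
  have := zero_le_dotProduct_self (B *ᵥ w)
  linarith

theorem sum_prob_mul_sub_transpose_sq_le (hB : B ≠ 0) (w : Fin n → ℝ) :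
    ∑ a, prob B a * ((B - rankOne B a)ᵀ *ᵥ w ⬝ᵥ (B - rankOne B a)ᵀ *ᵥ w) ≤
      n * frobSq B * (w ⬝ᵥ w) := by
  have h := sum_prob_mul_sub_sq_le (B := Bᵀ) (by simpa using hB) w
  rw [← (Equiv.prodComm (Fin n) (Fin n)).sum_comp, frobSq_transpose] at h
  simpa only [Equiv.prodComm_apply, prob_transpose, rankOne_transpose, transpose_sub] using h

theorem mulVec_sq_le_frobSq (M : Matrix (Fin n) (Fin n) ℝ) (w : Fin n → ℝ) :
    M *ᵥ w ⬝ᵥ M *ᵥ w ≤ frobSq M * (w ⬝ᵥ w) := by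
  rw [frobSq, Finset.sum_mul]
  refine Finset.sum_le_sum fun i _ => ?_
  have := dotProduct_sq_le (M i) w
  rw [← pow_two]
  refine this.trans (le_of_eq ?_)
  simp [dotProduct, pow_two]

theorem sub_sq_le {v w : Fin n → ℝ} {r : ℝ} (hv : v ⬝ᵥ v ≤ r) (hw : w ⬝ᵥ w ≤ r) :
    (v - w) ⬝ᵥ (v - w) ≤ 4 * r := by
  have h := zero_le_dotProduct_self (v + w)
  rw [add_dotProduct, dotProduct_add, dotProduct_add] at h
  rw [sub_dotProduct, dotProduct_sub, dotProduct_sub]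
  linarith

/-- If all non-zero entries of `B` are at least `δ` in absolute value, then both `B` and every
sample have norm at most `‖B‖_F² / δ`. -/
theorem sub_rankOne_mulVec_sq_le (hB : B ≠ 0) {δ : ℝ} (hδ : 0 < δ)
    (hBδ : ∀ i j, B i j ≠ 0 → δ ≤ |B i j|) (a : Fin n × Fin n) (w : Fin n → ℝ) :
    (B - rankOne B a) *ᵥ w ⬝ᵥ (B - rankOne B a) *ᵥ w ≤
      (2 * (frobSq B / δ)) ^ 2 * (w ⬝ᵥ w) := by
  have hF := frobSq_pos hB
  have hw := zero_le_dotProduct_self w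
  have hle : ∀ i j, B i j ^ 2 ≤ frobSq B := fun i j => by
    rw [frobSq_eq_sum]
    exact Finset.single_le_sum (f := fun a : Fin n × Fin n => B a.1 a.2 ^ 2)
      (fun _ _ => sq_nonneg _) (Finset.mem_univ (i, j))
  have hδF : δ ^ 2 ≤ frobSq B := by
    obtain ⟨i, j, hij⟩ : ∃ i j, B i j ≠ 0 := by
      by_contra! h
      exact hB (by ext i j; simpa using h i j)
    refine le_trans ?_ (hle i j)
    rw [← sq_abs (B i j)]
    exact pow_le_pow_left₀ hδ.le (hBδ i j hij) 2
  have h1 : B *ᵥ w ⬝ᵥ B *ᵥ w ≤ (frobSq B / δ) ^ 2 * (w ⬝ᵥ w) := by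
    refine (mulVec_sq_le_frobSq B w).trans ?_
    gcongr
    rw [div_pow, le_div_iff₀ (by positivity), pow_two (frobSq B)]
    gcongr
  have h2 : rankOne B a *ᵥ w ⬝ᵥ rankOne B a *ᵥ w ≤ (frobSq B / δ) ^ 2 * (w ⬝ᵥ w) := by
    rw [rankOne_mulVec_sq]
    have hwa : w a.2 ^ 2 ≤ w ⬝ᵥ w := by
      rw [pow_two]
      exact Finset.single_le_sum (f := fun i => w i * w i) (fun i _ => mul_self_nonneg _)
        (Finset.mem_univ a.2)
    refine mul_le_mul ?_ hwa (sq_nonneg _) (sq_nonneg _)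
    by_cases h0 : B a.1 a.2 = 0
    · rw [h0, zero_div, zero_pow two_ne_zero]
      exact sq_nonneg _
    · have : B a.1 a.2 / prob B a = frobSq B / B a.1 a.2 := by
        rw [prob]
        field_simp
      rw [this, div_pow, div_pow, ← sq_abs (B a.1 a.2)]
      gcongr
      exact hBδ _ _ h0
  rw [sub_mulVec]
  refine (sub_sq_le h1 h2).trans (le_of_eq ?_)
  ring

theorem sub_rankOne_transpose_mulVec_sq_le (hB : B ≠ 0) {δ : ℝ} (hδ : 0 < δ)
    (hBδ : ∀ i j, B i j ≠ 0 → δ ≤ |B i j|) (a : Fin n × Fin n) (w : Fin n → ℝ) :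
    (B - rankOne B a)ᵀ *ᵥ w ⬝ᵥ (B - rankOne B a)ᵀ *ᵥ w ≤
      (2 * (frobSq B / δ)) ^ 2 * (w ⬝ᵥ w) := by
  have h := sub_rankOne_mulVec_sq_le (B := Bᵀ) (by simpa using hB) hδ (fun i j => hBδ j i) a.swap w
  rwa [rankOne_transpose, frobSq_transpose, ← transpose_sub] at h

end Moments

/-! ### The matrix Bernstein bound for the sketch -/

section Bernstein

variable {n : ℕ} {B : Matrix (Fin n) (Fin n) ℝ}

theorem sub_sketch_eq {s : ℕ} (hs : s ≠ 0) (x : Fin s → Fin n × Fin n) :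
    ∑ t, (B - rankOne B (x t)) = (s : ℝ) • (B - sketch B s x) := by
  have hs' : (s : ℝ) ≠ 0 := Nat.cast_ne_zero.2 hs
  rw [sketch, smul_sub, smul_smul, mul_one_div_cancel hs', one_smul, Finset.sum_sub_distrib,
    Finset.sum_const, Finset.card_univ, Fintype.card_fin, Nat.cast_smul_eq_nsmul]
  rfl

/-- The quadratic form of `E exp (θ D)` for the dilation `D` of the centered sample. With
`ε = 2 n δ`, the scale `θ` is the usual choice in Bernstein's inequality: it gives `‖θ D‖ ≤ 6 / 5`
and the variance `θ² n ‖B‖_F²`. -/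
theorem sum_prob_mul_exp_dilation_le (hn : 1 ≤ n) (hB : B ≠ 0) {ε : ℝ} (hε : 0 < ε)
    (hBε : ∀ i j, B i j ≠ 0 → ε / (2 * n) ≤ |B i j|) (v : Fin n ⊕ Fin n → ℝ) :
    ∑ a, prob B a * (v ⬝ᵥ NormedSpace.exp
      ((3 * ε / (10 * n * frobSq B)) • dilation (B - rankOne B a)) *ᵥ v) ≤
      (1 + 3 * ε ^ 2 / (40 * n * frobSq B)) * (v ⬝ᵥ v) := by
  have hF := frobSq_pos hB
  have hn0 : (0 : ℝ) < n := by exact_mod_cast hn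
  set θ := 3 * ε / (10 * n * frobSq B) with hθ
  set d : Fin n × Fin n → Matrix (Fin n ⊕ Fin n) (Fin n ⊕ Fin n) ℝ :=
    fun a => dilation (B - rankOne B a) with hd
  have hsq : ∀ a (u w : Fin n → ℝ), d a *ᵥ Sum.elim u w ⬝ᵥ d a *ᵥ Sum.elim u w =
      (B - rankOne B a) *ᵥ w ⬝ᵥ (B - rankOne B a) *ᵥ w +
        (B - rankOne B a)ᵀ *ᵥ u ⬝ᵥ (B - rankOne B a)ᵀ *ᵥ u := fun a u w => by
    rw [hd, dilation_mulVec, sumElim_dotProduct_sumElim]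
  have hδ : 0 < ε / (2 * n) := by positivity
  have hsmul : ∀ a v, (θ • d a) *ᵥ v ⬝ᵥ (θ • d a) *ᵥ v = θ ^ 2 * (d a *ᵥ v ⬝ᵥ d a *ᵥ v) :=
    fun a v => by
      rw [smul_mulVec, smul_dotProduct, dotProduct_smul, smul_eq_mul, smul_eq_mul]
      ring
  have hbound : ∀ a v, (θ • d a) *ᵥ v ⬝ᵥ (θ • d a) *ᵥ v ≤ (6 / 5) ^ 2 * (v ⬝ᵥ v) := fun a v => by
    obtain ⟨u, w, rfl⟩ : ∃ u w, v = Sum.elim u w := ⟨_, _, (Sum.elim_comp_inl_inr v).symm⟩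
    rw [hsmul, hsq, sumElim_dotProduct_sumElim]
    have h1 := sub_rankOne_mulVec_sq_le hB hδ hBε a w
    have h2 := sub_rankOne_transpose_mulVec_sq_le hB hδ hBε a u
    have h3 : θ * (2 * (frobSq B / (ε / (2 * n)))) = 6 / 5 := by
      rw [hθ]; field_simp; norm_num
    calc θ ^ 2 * ((B - rankOne B a) *ᵥ w ⬝ᵥ (B - rankOne B a) *ᵥ w +
          (B - rankOne B a)ᵀ *ᵥ u ⬝ᵥ (B - rankOne B a)ᵀ *ᵥ u)
        ≤ θ ^ 2 * ((2 * (frobSq B / (ε / (2 * n)))) ^ 2 * (w ⬝ᵥ w) +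
          (2 * (frobSq B / (ε / (2 * n)))) ^ 2 * (u ⬝ᵥ u)) := by gcongr
      _ = (θ * (2 * (frobSq B / (ε / (2 * n))))) ^ 2 * (u ⬝ᵥ u + w ⬝ᵥ w) := by ring
      _ = _ := by rw [h3]
  have hmean : ∑ a, prob B a * (v ⬝ᵥ (θ • d a) *ᵥ v) = 0 := by
    have h0 : ∑ a, prob B a • (θ • d a) = 0 := by
      have h1 : ∑ a, prob B a • (B - rankOne B a) = 0 := by
        simp only [smul_sub, Finset.sum_sub_distrib]
        rw [sum_prob_smul_rankOne hB, ← Finset.sum_smul, sum_prob_eq_one hB, one_smul, sub_self]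
      have h2 : ∑ a, prob B a • (θ • d a) = θ • dilation (∑ a, prob B a • (B - rankOne B a)) := by
        rw [map_sum, Finset.smul_sum]
        refine Finset.sum_congr rfl fun a _ => ?_
        rw [map_smul, smul_comm]
      rw [h2, h1, map_zero, smul_zero]
    have h1 : ∑ a, prob B a * (v ⬝ᵥ (θ • d a) *ᵥ v) =
        v ⬝ᵥ (∑ a, prob B a • (θ • d a)) *ᵥ v := by
      rw [sum_mulVec, dotProduct_sum]
      refine Finset.sum_congr rfl fun a _ => ?_
      rw [smul_mulVec (prob B a), dotProduct_smul, smul_eq_mul]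
    rw [h1, h0, zero_mulVec, dotProduct_zero]
  have hvar : ∑ a, prob B a * ((θ • d a) *ᵥ v ⬝ᵥ (θ • d a) *ᵥ v) ≤
      θ ^ 2 * (n * frobSq B) * (v ⬝ᵥ v) := by
    obtain ⟨u, w, rfl⟩ : ∃ u w, v = Sum.elim u w := ⟨_, _, (Sum.elim_comp_inl_inr v).symm⟩
    have h1 := sum_prob_mul_sub_sq_le hB w
    have h2 := sum_prob_mul_sub_transpose_sq_le hB u
    have h3 : ∑ a, prob B a * ((θ • d a) *ᵥ Sum.elim u w ⬝ᵥ (θ • d a) *ᵥ Sum.elim u w) =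
        θ ^ 2 * (∑ a, prob B a * ((B - rankOne B a) *ᵥ w ⬝ᵥ (B - rankOne B a) *ᵥ w) +
          ∑ a, prob B a * ((B - rankOne B a)ᵀ *ᵥ u ⬝ᵥ (B - rankOne B a)ᵀ *ᵥ u)) := by
      rw [← Finset.sum_add_distrib, Finset.mul_sum]
      refine Finset.sum_congr rfl fun a _ => ?_
      rw [hsmul, hsq]
      ring
    rw [h3, sumElim_dotProduct_sumElim, mul_assoc]
    gcongr
    linarith
  calc ∑ a, prob B a * (v ⬝ᵥ NormedSpace.exp (θ • d a) *ᵥ v)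
      ≤ ∑ a, prob B a * (v ⬝ᵥ v + v ⬝ᵥ (θ • d a) *ᵥ v +
          5 / 6 * ((θ • d a) *ᵥ v ⬝ᵥ (θ • d a) *ᵥ v)) := by
        gcongr with a
        · exact prob_nonneg B a
        · exact dotProduct_exp_mulVec_le ((dilation_isSymm _).smul θ) (hbound a) v
    _ = v ⬝ᵥ v + 5 / 6 * ∑ a, prob B a * ((θ • d a) *ᵥ v ⬝ᵥ (θ • d a) *ᵥ v) := by
        simp only [mul_add, Finset.sum_add_distrib]
        rw [hmean, ← Finset.sum_mul, sum_prob_eq_one hB, one_mul, add_zero, Finset.mul_sum]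
        congr 1
        exact Finset.sum_congr rfl fun a _ => by ring
    _ ≤ v ⬝ᵥ v + 5 / 6 * (θ ^ 2 * (n * frobSq B) * (v ⬝ᵥ v)) := by gcongr
    _ = (1 + 3 * ε ^ 2 / (40 * n * frobSq B)) * (v ⬝ᵥ v) := by
        rw [hθ]
        field_simp
        ring

open Classical in
/-- The **matrix Bernstein inequality** for the sketch: an exponential tail bound for
the probability that the sketch is further than `ε / 2` from `B`. -/
theorem sum_prod_prob_le (hn : 1 ≤ n) (hB : B ≠ 0) {ε : ℝ} (hε : 0 < ε)
    (hBε : ∀ i j, B i j ≠ 0 → ε / (2 * n) ≤ |B i j|) (s : ℕ) :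
    ∑ x : Fin s → Fin n × Fin n,
      (if specNorm (B - sketch B s x) ≤ ε / 2 then 0 else ∏ t, prob B (x t)) ≤
      2 * n * Real.exp (-(3 * s * ε ^ 2 / (40 * n * frobSq B))) := by
  have hF := frobSq_pos hB
  have hn0 : (0 : ℝ) < n := by exact_mod_cast hn
  have hprod : ∀ x : Fin s → Fin n × Fin n, 0 ≤ ∏ t, prob B (x t) := fun x =>
    Finset.prod_nonneg fun t _ => prob_nonneg B _
  set θ := 3 * ε / (10 * n * frobSq B) with hθ
  have hθ0 : 0 < θ := by positivity
  have hmain := sum_prod_mul_trace_exp_le (prob_nonneg B)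
    (fun a => (dilation_isSymm (B - rankOne B a)).smul θ) (by positivity)
    (sum_prob_mul_exp_dilation_le hn hB hε hBε) s
  have hbad : ∀ x : Fin s → Fin n × Fin n, ¬ specNorm (B - sketch B s x) ≤ ε / 2 →
      Real.exp (θ * s * (ε / 2)) ≤
        trace (NormedSpace.exp (∑ t, θ • dilation (B - rankOne B (x t)))) := fun x hx => by
    rcases Nat.eq_zero_or_pos s with rfl | hs
    · have : (1 : ℝ) ≤ n := by exact_mod_cast hn
      simp [trace]
      linarith
    · by_contra! hlt
      have hs0 : (0 : ℝ) < s := by exact_mod_cast hs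
      rw [← Finset.smul_sum, ← map_sum, sub_sketch_eq hs.ne', map_smul, smul_smul] at hlt
      refine hx (specNorm_le_of_dilation (by positivity) fun v => ?_)
      have h := dotProduct_mulVec_le_of_trace_exp_lt ((dilation_isSymm _).smul _) hlt v
      rw [smul_mulVec, dotProduct_smul, smul_eq_mul, mul_assoc (θ * s)] at h
      exact le_of_mul_le_mul_left h (by positivity)
  have hmarkov : (∑ x : Fin s → Fin n × Fin n,
      (if specNorm (B - sketch B s x) ≤ ε / 2 then 0 else ∏ t, prob B (x t))) *
        Real.exp (θ * s * (ε / 2)) ≤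
      (1 + 3 * ε ^ 2 / (40 * n * frobSq B)) ^ s * Fintype.card (Fin n ⊕ Fin n) := by
    refine le_trans ?_ hmain
    rw [Finset.sum_mul]
    refine Finset.sum_le_sum fun x _ => ?_
    split_ifs with h
    · rw [zero_mul]
      exact mul_nonneg (hprod x) (trace_exp_nonneg
        (isSymm_sum (fun t => (dilation_isSymm _).smul θ) _))
    · exact mul_le_mul_of_nonneg_left (hbad x h) (hprod x)
  rw [← le_div_iff₀ (Real.exp_pos _)] at hmarkov
  refine hmarkov.trans ?_
  rw [div_le_iff₀ (Real.exp_pos _), mul_assoc (2 * (n : ℝ)), ← Real.exp_add]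
  have hexp : -(3 * s * ε ^ 2 / (40 * n * frobSq B)) + θ * s * (ε / 2) =
      s * (3 * ε ^ 2 / (40 * n * frobSq B)) := by
    rw [hθ]; field_simp; ring
  rw [hexp, Real.exp_nat_mul, Fintype.card_sum, Fintype.card_fin]
  have : 1 + 3 * ε ^ 2 / (40 * n * frobSq B) ≤ Real.exp (3 * ε ^ 2 / (40 * n * frobSq B)) := by
    rw [add_comm]; exact Real.add_one_le_exp _
  push_cast
  calc (1 + 3 * ε ^ 2 / (40 * n * frobSq B)) ^ s * ((n : ℝ) + n)
      ≤ Real.exp (3 * ε ^ 2 / (40 * n * frobSq B)) ^ s * ((n : ℝ) + n) := by gcongr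
    _ = _ := by ring

end Bernstein

/-! ### Accuracy and sparsity of the sketch -/

section Accuracy

variable {n : ℕ}

theorem le_abs_trunc_of_ne_zero {A : Matrix (Fin n) (Fin n) ℝ} {ε : ℝ} (i j : Fin n)
    (h : trunc A ε i j ≠ 0) : ε / (2 * n) ≤ |trunc A ε i j| := by
  simp only [trunc, of_apply] at h ⊢
  split_ifs at h ⊢ with h1
  · exact absurd rfl h
  · exact not_lt.1 h1

theorem frobSq_trunc_le (A : Matrix (Fin n) (Fin n) ℝ) (ε : ℝ) :
    frobSq (trunc A ε) ≤ frobSq A := by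
  refine Finset.sum_le_sum fun i _ => Finset.sum_le_sum fun j _ => ?_
  simp only [trunc, of_apply]
  split_ifs
  · simpa using sq_nonneg (A i j)
  · exact le_rfl

theorem specNorm_sub_trunc_le (hn : 1 ≤ n) (A : Matrix (Fin n) (Fin n) ℝ) {ε : ℝ} (hε : 0 < ε) :
    specNorm (A - trunc A ε) ≤ ε / 2 := by
  have hn0 : (0 : ℝ) < n := by exact_mod_cast hn
  refine (specNorm_le_iff (by positivity)).2 fun w => (mulVec_sq_le_frobSq _ w).trans ?_
  refine mul_le_mul_of_nonneg_right ?_ (zero_le_dotProduct_self w)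
  calc frobSq (A - trunc A ε) ≤ ∑ _i : Fin n, ∑ _j : Fin n, (ε / (2 * n)) ^ 2 := by
        refine Finset.sum_le_sum fun i _ => Finset.sum_le_sum fun j _ => ?_
        simp only [trunc, Matrix.sub_apply, of_apply]
        split_ifs with h
        · rw [sub_zero, ← sq_abs]
          gcongr
        · rw [sub_self, zero_pow two_ne_zero]
          exact sq_nonneg _
    _ = (ε / 2) ^ 2 := by
        simp only [Finset.sum_const, Finset.card_univ, Fintype.card_fin, nsmul_eq_mul]
        field_simp

theorem specNorm_sub_le (A B M : Matrix (Fin n) (Fin n) ℝ) :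
    specNorm (A - M) ≤ specNorm (A - B) + specNorm (B - M) := by
  rw [← sub_add_sub_cancel A B M, specNorm, map_add]
  exact norm_add_le _ _

theorem nnz_sketch_le (B : Matrix (Fin n) (Fin n) ℝ) (s : ℕ) (x : Fin s → Fin n × Fin n) :
    nnz (sketch B s x) ≤ s := by
  have hsub : {y : Fin n × Fin n | sketch B s x y.1 y.2 ≠ 0} ⊆ Set.range x := by
    intro y hy
    by_contra hx
    refine hy ?_
    rw [sketch, Matrix.smul_apply, Matrix.sum_apply, Finset.sum_eq_zero, smul_zero]
    intro t _
    refine single_apply_of_ne _ _ _ _ _ fun h => hx ⟨t, Prod.ext h.1 h.2⟩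
  calc nnz (sketch B s x) ≤ (Set.range x).ncard := Set.ncard_le_ncard hsub (Set.toFinite _)
    _ ≤ s := by
      rw [← Set.image_univ]
      refine (Set.ncard_image_le (Set.toFinite _)).trans (le_of_eq ?_)
      rw [Set.ncard_univ, Nat.card_fin]

theorem iid_apply {α : Type} (p : PMF α) (s : ℕ) (x : Fin s → α) :
    iid p s x = ∏ t, p (x t) := by
  classical
  induction s with
  | zero => simp [iid, Subsingleton.elim x Fin.elim0]
  | succ s ih =>
    rw [iid, PMF.bind_apply, tsum_eq_single (x 0), PMF.map_apply, tsum_eq_single (Fin.tail x),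
      if_pos (Fin.cons_self_tail x).symm, ih, Fin.prod_univ_succ]
    · rfl
    · intro f hf
      refine if_neg fun h => hf ?_
      rw [h, Fin.tail_cons]
    · intro a ha
      rw [PMF.map_apply, ENNReal.tsum_eq_zero.2, mul_zero]
      intro f
      refine if_neg fun h => ha ?_
      rw [h, Fin.cons_zero]

open Classical in
theorem le_toOuterMeasure_iid {B : Matrix (Fin n) (Fin n) ℝ} (hB : B ≠ 0) (s : ℕ)
    (U : Set (Fin s → Fin n × Fin n)) {q : ℝ}
    (h : ∑ x, (if x ∈ U then 0 else ∏ t, prob B (x t)) ≤ q) :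
    ENNReal.ofReal (1 - q) ≤ (iid (indexLaw B hB) s).toOuterMeasure U := by
  have hprod : ∀ x : Fin s → Fin n × Fin n, 0 ≤ ∏ t, prob B (x t) := fun x =>
    Finset.prod_nonneg fun t _ => prob_nonneg B _
  have h1 : (iid (indexLaw B hB) s).toOuterMeasure U =
      ENNReal.ofReal (∑ x, if x ∈ U then ∏ t, prob B (x t) else 0) := by
    rw [PMF.toOuterMeasure_apply_fintype, ENNReal.ofReal_sum_of_nonneg]
    · refine Finset.sum_congr rfl fun x _ => ?_
      rw [Set.indicator_apply]
      split_ifs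
      · rw [iid_apply, ENNReal.ofReal_prod_of_nonneg fun t _ => prob_nonneg B _]
        rfl
      · simp
    · intro x _
      split_ifs
      exacts [hprod x, le_rfl]
  have h2 : ∑ x : Fin s → Fin n × Fin n, ∏ t, prob B (x t) = 1 := by
    rw [← Fintype.sum_pow, sum_prob_eq_one hB, one_pow]
  have h3 : (∑ x : Fin s → Fin n × Fin n, if x ∈ U then ∏ t, prob B (x t) else 0) +
      ∑ x, (if x ∈ U then 0 else ∏ t, prob B (x t)) = 1 := by
    rw [← Finset.sum_add_distrib, ← h2]
    refine Finset.sum_congr rfl fun x _ => ?_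
    split_ifs <;> simp
  rw [h1]
  exact ENNReal.ofReal_le_ofReal (by linarith)

theorem le_sketchLaw_specNorm_le (hn : 1 ≤ n) (A : Matrix (Fin n) (Fin n) ℝ) {ε : ℝ} (hε : 0 < ε)
    {s : ℕ} (hs : 28 * n * Real.log (Real.sqrt 2 * n) / ε ^ 2 * frobSq A ≤ (s : ℝ)) :
    ENNReal.ofReal (1 - 1 / (n : ℝ)) ≤
      (sketchLaw A ε s).toOuterMeasure {M | specNorm (A - M) ≤ ε} := by
  classical
  have hn1 : (1 : ℝ) ≤ n := by exact_mod_cast hn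
  have hn0 : (0 : ℝ) < n := by linarith
  have htr := specNorm_sub_trunc_le hn A hε
  rw [sketchLaw]
  split_ifs with hB
  · rw [hB] at htr
    rw [PMF.toOuterMeasure_pure_apply,
      if_pos (Set.mem_ofPred_eq ▸ (by linarith : specNorm (A - 0) ≤ ε))]
    rw [← ENNReal.ofReal_one]
    exact ENNReal.ofReal_le_ofReal (by linarith [one_div_pos.2 hn0])
  · have hF := frobSq_pos hB
    rw [PMF.toOuterMeasure_map_apply]
    refine (le_toOuterMeasure_iid hB s {x | specNorm (trunc A ε - sketch (trunc A ε) s x) ≤ ε / 2}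
      (q := 1 / n) ?_).trans ?_
    · refine (sum_prod_prob_le hn hB hε le_abs_trunc_of_ne_zero s).trans ?_
      have hlog2 : 2 * Real.log (Real.sqrt 2 * n) = Real.log (2 * n ^ 2) := by
        rw [← Real.log_rpow (by positivity), Real.mul_rpow (by positivity) hn0.le,
          Real.rpow_two, Real.rpow_two, Real.sq_sqrt (by norm_num)]
      have hlog0 : 0 ≤ Real.log (Real.sqrt 2 * n) := by
        have : 0 ≤ Real.log (2 * n ^ 2) := Real.log_nonneg (by nlinarith)
        linarith
      -- the bound on `s` makes the right-hand side at least `(3 * 28 / 40) * log (√2 n)`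
      have hexp : Real.log (2 * n ^ 2) ≤ 3 * s * ε ^ 2 / (40 * n * frobSq (trunc A ε)) := by
        rw [le_div_iff₀ (by positivity), ← hlog2]
        have h1 : 28 * n * Real.log (Real.sqrt 2 * n) * frobSq A ≤ s * ε ^ 2 := by
          rwa [div_mul_eq_mul_div, div_le_iff₀ (by positivity)] at hs
        have h2 : n * Real.log (Real.sqrt 2 * n) * frobSq (trunc A ε) ≤
            n * Real.log (Real.sqrt 2 * n) * frobSq A := by
          gcongr
          exact frobSq_trunc_le A ε
        have h3 : 0 ≤ n * Real.log (Real.sqrt 2 * n) * frobSq (trunc A ε) := by positivity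
        linarith
      calc 2 * n * Real.exp (-(3 * s * ε ^ 2 / (40 * n * frobSq (trunc A ε))))
          ≤ 2 * n * Real.exp (-Real.log (2 * n ^ 2)) := by gcongr
        _ = 1 / n := by
          rw [Real.exp_neg, Real.exp_log (by positivity)]
          field_simp
    · refine MeasureTheory.measure_mono fun x hx => ?_
      have := specNorm_sub_le A (trunc A ε) (sketch (trunc A ε) s x)
      simp only [Set.mem_ofPred_eq, Set.mem_preimage] at hx ⊢
      linarith

theorem nnz_le_of_mem_support {A : Matrix (Fin n) (Fin n) ℝ} {ε : ℝ} {s : ℕ}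
    {M : Matrix (Fin n) (Fin n) ℝ} (hM : M ∈ (sketchLaw A ε s).support) : nnz M ≤ s := by
  rw [sketchLaw] at hM
  split_ifs at hM
  · rw [PMF.mem_support_pure_iff] at hM
    simp [hM, nnz]
  · obtain ⟨x, -, rfl⟩ := (PMF.mem_support_map_iff _ _ _).1 hM
    exact nnz_sketch_le _ _ _

end Accuracy

/-! ### Laws of independent tuples -/

theorem iid_pure {α : Type} (a : α) (s : ℕ) : iid (PMF.pure a) s = PMF.pure fun _ => a := by
  induction s with
  | zero => rw [iid, Subsingleton.elim (fun _ => a) Fin.elim0]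
  | succ s ih =>
    rw [iid, PMF.pure_bind, ih, PMF.pure_map]
    congr 1
    exact Fin.cons_self_tail (fun _ => a)

/-- Combining two independent i.i.d. tuples entry by entry gives an i.i.d. tuple. -/
theorem iid_bind_iid_map {α β γ : Type} (p : PMF α) (q : PMF β) (comb : α → β → γ) (s : ℕ) :
    ((iid p s).bind fun f => (iid q s).map fun g t => comb (f t) (g t)) =
      iid (p.bind fun a => q.map (comb a)) s := by
  induction s with
  | zero =>
    simp only [iid, PMF.map, PMF.pure_bind, Function.comp]
    rw [Subsingleton.elim (fun t => _) Fin.elim0]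
  | succ s ih =>
    rw [iid, iid, iid, ← ih]
    simp only [PMF.map, PMF.bind_bind, PMF.pure_bind, Function.comp]
    congr 1
    funext a
    rw [PMF.bind_comm]
    congr 1
    funext b
    congr 1
    funext f
    congr 1
    funext g
    congr 1
    funext t
    cases t using Fin.cases <;> rfl

/-! ### The reservoir-sampling program -/

section Reservoir

variable {n s : ℕ}

/-- Overwrite the sample number `t` by the current item. Its row and column are in the
index registers `t` and `s + t`, its value is in the real register `t + 2`. -/
def storeCmd (t : Fin s) : Cmd (s + s) (s + 2) :=
  .seq (.readRow (Fin.castAdd s t)) (.seq (.readCol (Fin.natAdd s t)) (.readVal t.succ.succ))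

/-- Overwrite each of the listed samples independently with probability `v² / W`, where the real
registers `0` and `1` hold the total weight `W` so far and the current value `v`. -/
noncomputable def resampleCmd : List (Fin s) → Cmd (s + s) (s + 2)
  | [] => .skip
  | t :: l =>
    .seq (.coin (.div (.mul (.reg (Fin.succ 0)) (.reg (Fin.succ 0))) (.reg 0)) (storeCmd t) .skip)
      (resampleCmd l)

/-- Add the current squared value to the total weight and resample all entries. -/
noncomputable def keepCmd (s : ℕ) : Cmd (s + s) (s + 2) :=
  .seq (.set 0 (.add (.reg 0) (.mul (.reg (Fin.succ 0)) (.reg (Fin.succ 0)))))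
    (resampleCmd (List.ofFn id))

/-- Weighted reservoir sampling with `s` independent reservoirs of size one, for the items of
absolute value at least `τ`. -/
noncomputable abbrev reservoir (s : ℕ) (τ : ℝ) : Program where
  k := s + s
  m := s + 2
  body := .seq (.readVal (Fin.succ 0))
    (.ifLt (.reg (Fin.succ 0)) (.const τ)
      (.ifLt (.sub (.const 0) (.reg (Fin.succ 0))) (.const τ) .skip (keepCmd s)) (keepCmd s))
  out := List.ofFn fun t : Fin s =>
    (Fin.castAdd s t, Fin.natAdd s t, .div (.div (.reg 0) (.reg t.succ.succ)) (.const s))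

/-- The memory that holds the total weight `W`, the value `v` and the samples `o`. A reservoir
that has not been filled yet, `o t = none`, consists of zeros. -/
def memOf (B : Matrix (Fin n) (Fin n) ℝ) (W v : ℝ) (o : Fin s → Option (Fin n × Fin n)) :
    Mem (s + s) (s + 2) where
  idx := Fin.append (fun t => (o t).elim 0 fun a => a.1) (fun t => (o t).elim 0 fun a => a.2)
  val := Fin.cons W (Fin.cons v fun t => (o t).elim 0 fun a => B a.1 a.2)

theorem update_append_castAdd {α : Type} (f g : Fin s → α) (t : Fin s) (a : α) :
    Function.update (Fin.append f g) (Fin.castAdd s t) a =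
      Fin.append (Function.update f t a) g := by
  funext i
  induction i using Fin.addCases with
  | left i => simp only [Function.update_apply, Fin.append_left, Fin.castAdd_inj]
  | right i =>
    rw [Function.update_of_ne, Fin.append_right, Fin.append_right]
    intro h
    have := congrArg Fin.val h
    simp only [Fin.val_natAdd, Fin.val_castAdd] at this
    omega

theorem update_append_natAdd {α : Type} (f g : Fin s → α) (t : Fin s) (a : α) :
    Function.update (Fin.append f g) (Fin.natAdd s t) a =
      Fin.append f (Function.update g t a) := by
  funext i
  induction i using Fin.addCases with
  | right i => simp only [Function.update_apply, Fin.append_right, Fin.natAdd_inj]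
  | left i =>
    rw [Function.update_of_ne, Fin.append_left, Fin.append_left]
    intro h
    have := congrArg Fin.val h
    simp only [Fin.val_natAdd, Fin.val_castAdd] at this
    omega

theorem update_optionElim {α β : Type} (o : Fin s → Option α) (t : Fin s) (a : α)
    (b : β) (f : α → β) : Function.update (fun t => (o t).elim b f) t (f a) =
      fun u => (Function.update o t (some a) u).elim b f := by
  funext u
  by_cases h : u = t
  · subst h; simp
  · simp [Function.update_of_ne h]

theorem storeCmd_exec (B : Matrix (Fin n) (Fin n) ℝ) (W v : ℝ)
    (o : Fin s → Option (Fin n × Fin n)) (a : Fin n × Fin n) (t : Fin s) :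
    (storeCmd t).exec a.1 a.2 (B a.1 a.2) (memOf B W v o) =
      PMF.pure (memOf B W v (Function.update o t (some a))) := by
  simp only [storeCmd, Cmd.exec, PMF.pure_bind, memOf, update_append_castAdd,
    update_append_natAdd, ← Fin.cons_update]
  rw [update_optionElim o t a 0 fun a => (a.1 : ℕ), update_optionElim o t a 0 fun a => (a.2 : ℕ),
    update_optionElim o t a 0 fun a => B a.1 a.2]

open Classical in
theorem resampleCmd_exec (B : Matrix (Fin n) (Fin n) ℝ) (W : ℝ) (a : Fin n × Fin n) {j : ℕ}
    (e : Fin j → Fin s) (o : Fin s → Option (Fin n × Fin n)) :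
    (resampleCmd (List.ofFn e)).exec a.1 a.2 (B a.1 a.2) (memOf B W (B a.1 a.2) o) =
      (iid (coinLaw (B a.1 a.2 ^ 2 / W)) j).map fun b =>
        memOf B W (B a.1 a.2) fun t => if ∃ i, e i = t ∧ b i = true then some a else o t := by
  induction j generalizing o with
  | zero => simp [resampleCmd, Cmd.exec, iid, PMF.pure_map]
  | succ j ih =>
    have hp : RExpr.eval (memOf B W (B a.1 a.2) o).val
        (.div (.mul (.reg (Fin.succ 0)) (.reg (Fin.succ 0))) (.reg 0)) =
          B a.1 a.2 ^ 2 / W := by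
      simp [RExpr.eval, memOf, pow_two]
    rw [List.ofFn_succ, resampleCmd, Cmd.exec, Cmd.exec, hp, iid, PMF.bind_bind, PMF.map_bind]
    congr 1
    funext b
    rw [PMF.map_comp]
    cases b
    · simp only [Bool.false_eq_true, if_false, Cmd.exec, PMF.pure_bind]
      rw [ih]
      congr 1
      funext b
      simp [Fin.exists_fin_succ]
    · simp only [if_true, storeCmd_exec, PMF.pure_bind]
      rw [ih]
      congr 1
      funext b
      simp only [Function.comp, Fin.exists_fin_succ, Fin.cons_zero, Fin.cons_succ, and_true]
      congr 1
      funext t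
      by_cases h : e 0 = t
      · subst h; simp
      · simp [h, Function.update_of_ne (Ne.symm h)]

theorem keepCmd_exec (B : Matrix (Fin n) (Fin n) ℝ) (W : ℝ) (a : Fin n × Fin n)
    (o : Fin s → Option (Fin n × Fin n)) :
    (keepCmd s).exec a.1 a.2 (B a.1 a.2) (memOf B W (B a.1 a.2) o) =
      (iid (coinLaw (B a.1 a.2 ^ 2 / (W + B a.1 a.2 ^ 2))) s).map fun b =>
        memOf B (W + B a.1 a.2 ^ 2) (B a.1 a.2) fun t => if b t = true then some a else o t := by
  have h : (Cmd.set (k := s + s) (m := s + 2) 0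
      (.add (.reg 0) (.mul (.reg (Fin.succ 0)) (.reg (Fin.succ 0))))).exec a.1 a.2 (B a.1 a.2)
        (memOf B W (B a.1 a.2) o) =
      PMF.pure (memOf B (W + B a.1 a.2 ^ 2) (B a.1 a.2) o) := by
    simp [Cmd.exec, RExpr.eval, memOf, pow_two, Fin.update_cons_zero]
  rw [keepCmd, Cmd.exec, h, PMF.pure_bind, resampleCmd_exec]
  simp

theorem reservoir_body_exec_of_eq_zero {A : Matrix (Fin n) (Fin n) ℝ} {ε : ℝ}
    {a : Fin n × Fin n} (hn : 1 ≤ n) (hε : 0 < ε) (ha : trunc A ε a.1 a.2 = 0) (W v : ℝ)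
    (o : Fin s → Option (Fin n × Fin n)) :
    (reservoir s (ε / (2 * n))).body.exec a.1 a.2 (A a.1 a.2) (memOf (trunc A ε) W v o) =
      PMF.pure (memOf (trunc A ε) W (A a.1 a.2) o) := by
  have hn0 : (0 : ℝ) < n := by exact_mod_cast hn
  have hlt : |A a.1 a.2| < ε / (2 * n) := by
    by_contra h
    simp only [trunc, of_apply, if_neg h] at ha
    rw [ha, abs_zero] at h
    exact h (by positivity)
  rw [abs_lt] at hlt
  have h2 : 0 - A a.1 a.2 < ε / (2 * n) := by linarith
  simp only [reservoir, Cmd.exec, PMF.pure_bind, RExpr.eval, memOf, ← Fin.cons_update,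
    Fin.update_cons_zero, Fin.cons_succ, Fin.cons_zero, if_pos hlt.2, if_pos h2]

theorem reservoir_body_exec_of_ne_zero {A : Matrix (Fin n) (Fin n) ℝ} {ε : ℝ}
    {a : Fin n × Fin n} (ha : trunc A ε a.1 a.2 ≠ 0) (W v : ℝ)
    (o : Fin s → Option (Fin n × Fin n)) :
    (reservoir s (ε / (2 * n))).body.exec a.1 a.2 (A a.1 a.2) (memOf (trunc A ε) W v o) =
      (keepCmd s).exec a.1 a.2 (trunc A ε a.1 a.2)
        (memOf (trunc A ε) W (trunc A ε a.1 a.2) o) := by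
  have hle : ¬ |A a.1 a.2| < ε / (2 * n) := fun h => ha (by simp only [trunc, of_apply, if_pos h])
  have hA : trunc A ε a.1 a.2 = A a.1 a.2 := by simp only [trunc, of_apply, if_neg hle]
  have hor : ¬ A a.1 a.2 < ε / (2 * n) ∨ ¬ 0 - A a.1 a.2 < ε / (2 * n) := by
    rw [← not_and_or]
    exact fun h => hle (abs_lt.2 ⟨by linarith [h.2], h.1⟩)
  rw [hA]
  simp only [reservoir, Cmd.exec, PMF.pure_bind, RExpr.eval, memOf, ← Fin.cons_update,
    Fin.update_cons_zero, Fin.cons_succ, Fin.cons_zero]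
  rcases hor with h | h
  · rw [if_neg h]
  · rw [if_neg h, ite_self]

theorem coinLaw_true (p : ℝ) : coinLaw p true = min 1 (ENNReal.ofReal p) := by
  simp [coinLaw]

theorem coinLaw_false (p : ℝ) : coinLaw p false = 1 - min 1 (ENNReal.ofReal p) := by
  simp [coinLaw]

/-- The invariant of reservoir sampling. When exactly the positions in `l` are still to come, `W`
is the total weight of the positions read so far, and `q` is the law of one reservoir: a position
that has been read is held with probability proportional to its weight, and the reservoir is
empty as long as the total weight is zero. -/
structure IsReservoirLaw (B : Matrix (Fin n) (Fin n) ℝ) (l : List (Fin n × Fin n)) (W : ℝ)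
    (q : PMF (Option (Fin n × Fin n))) : Prop where
  weight : W = ∑ y, if y ∈ l then 0 else B y.1 y.2 ^ 2
  some : ∀ y, q (some y) = if y ∈ l then 0 else ENNReal.ofReal (B y.1 y.2 ^ 2 / W)
  none : q none = if W = 0 then 1 else 0

theorem IsReservoirLaw.of_cons_eq_zero {B : Matrix (Fin n) (Fin n) ℝ} {a : Fin n × Fin n}
    {l : List (Fin n × Fin n)} {W : ℝ} {q : PMF (Option (Fin n × Fin n))}
    (h : IsReservoirLaw B (a :: l) W q) (ha : B a.1 a.2 = 0) : IsReservoirLaw B l W q where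
  weight := by
    rw [h.weight]
    refine Finset.sum_congr rfl fun y _ => ?_
    by_cases hy : y = a
    · subst hy; simp [ha]
    · simp [hy]
  some y := by
    rw [h.some]
    by_cases hy : y = a
    · subst hy; simp [ha]
    · simp [hy]
  none := h.none

/-- One step of reservoir sampling: overwriting the reservoir with probability `b² / (W + b²)`
keeps all probabilities proportional to the weights. -/
theorem IsReservoirLaw.of_cons_ne_zero {B : Matrix (Fin n) (Fin n) ℝ} {a : Fin n × Fin n}
    {l : List (Fin n × Fin n)} {W : ℝ} {q : PMF (Option (Fin n × Fin n))}
    (h : IsReservoirLaw B (a :: l) W q) (hal : a ∉ l) (ha : B a.1 a.2 ≠ 0) :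
    IsReservoirLaw B l (W + B a.1 a.2 ^ 2)
      (q.bind fun o => (coinLaw (B a.1 a.2 ^ 2 / (W + B a.1 a.2 ^ 2))).map fun b =>
        if b = true then Option.some a else o) := by
  have hterm : ∀ y ∈ (Finset.univ : Finset (Fin n × Fin n)),
      0 ≤ if y ∈ a :: l then 0 else B y.1 y.2 ^ 2 := fun y _ => by
    split_ifs
    exacts [le_rfl, sq_nonneg _]
  have hW : 0 ≤ W := h.weight ▸ Finset.sum_nonneg hterm
  have hb : 0 < B a.1 a.2 ^ 2 := by positivity
  set p := B a.1 a.2 ^ 2 / (W + B a.1 a.2 ^ 2) with hp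
  have hp0 : 0 ≤ p := by positivity
  have hp1 : p ≤ 1 := div_le_one_of_le₀ (by linarith) (by linarith)
  have hmin : min 1 (ENNReal.ofReal p) = ENNReal.ofReal p :=
    min_eq_right (by rw [← ENNReal.ofReal_one]; exact ENNReal.ofReal_le_ofReal hp1)
  have h1p : 1 - ENNReal.ofReal p = ENNReal.ofReal (W / (W + B a.1 a.2 ^ 2)) := by
    rw [← ENNReal.ofReal_one, ← ENNReal.ofReal_sub _ hp0]
    congr 1
    rw [hp]
    field_simp
    ring
  have hq : ∀ o, (q.bind fun o => (coinLaw p).map fun b =>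
      if b = true then Option.some a else o) o =
        ENNReal.ofReal (W / (W + B a.1 a.2 ^ 2)) * q o +
          ENNReal.ofReal p * PMF.pure (Option.some a) o := fun o => by
    have h1 : (q.bind fun o => (coinLaw p).map fun b => if b = true then Option.some a else o) =
        (coinLaw p).bind fun b => q.map fun o => if b = true then Option.some a else o := by
      simp only [PMF.map]
      exact PMF.bind_comm _ _ _
    have h2 : q.map (fun _ => Option.some a) = PMF.pure (Option.some a) := PMF.map_const _ _
    have h3 : q.map (fun o => o) = q := PMF.map_id q
    rw [h1, PMF.bind_apply, tsum_bool, coinLaw_true, coinLaw_false, hmin, h1p]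
    simp only [Bool.false_eq_true, if_false, if_true]
    rw [h2, h3]
  refine ⟨?_, fun y => ?_, ?_⟩
  · have h1 : ∀ y, (if y ∈ l then 0 else B y.1 y.2 ^ 2) =
        (if y ∈ a :: l then 0 else B y.1 y.2 ^ 2) +
          if y = a then B a.1 a.2 ^ 2 else 0 := fun y => by
      by_cases hy : y = a
      · subst hy; simp [hal]
      · simp [hy]
    rw [Finset.sum_congr rfl fun y _ => h1 y, Finset.sum_add_distrib, ← h.weight,
      Finset.sum_ite_eq' Finset.univ a, if_pos (Finset.mem_univ a)]
  · rw [hq, h.some, PMF.pure_apply]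
    by_cases hy : y = a
    · subst hy
      simp [hal, hp]
    · have hne : Option.some y ≠ Option.some a := fun h => hy (Option.some_injective _ h)
      rw [if_neg hne, mul_zero, add_zero]
      by_cases hyl : y ∈ l
      · simp [hyl]
      · have hyal : y ∉ a :: l := by simp [hy, hyl]
        rw [if_neg hyal, if_neg hyl, ← ENNReal.ofReal_mul (by positivity)]
        congr 1
        rcases hW.eq_or_lt with hW0 | hW0
        · -- no weight has been seen so far, in particular not at `y`
          have := (Finset.sum_eq_zero_iff_of_nonneg hterm).1 (h.weight.symm.trans hW0.symm) y
            (Finset.mem_univ y)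
          rw [if_neg hyal] at this
          simp [this]
        · field_simp
  · rw [hq, h.none, PMF.pure_apply, if_neg (Option.some_ne_none a).symm, mul_zero, add_zero,
      if_neg (show W + B a.1 a.2 ^ 2 ≠ 0 by positivity)]
    split_ifs with h0 <;> simp [h0]

theorem IsReservoirLaw.of_all_mem {B : Matrix (Fin n) (Fin n) ℝ} {l : List (Fin n × Fin n)}
    (hl : ∀ x, x ∈ l) : IsReservoirLaw B l 0 (PMF.pure Option.none) where
  weight := by simp [hl]
  some y := by simp [hl]
  none := by simp

theorem IsReservoirLaw.weight_eq_of_nil {B : Matrix (Fin n) (Fin n) ℝ} {W : ℝ}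
    {q : PMF (Option (Fin n × Fin n))} (h : IsReservoirLaw B [] W q) : W = frobSq B := by
  simpa [frobSq_eq_sum] using h.weight

theorem IsReservoirLaw.eq_indexLaw_of_nil {B : Matrix (Fin n) (Fin n) ℝ} {W : ℝ}
    {q : PMF (Option (Fin n × Fin n))} (h : IsReservoirLaw B [] W q) (hB : B ≠ 0) :
    q = (indexLaw B hB).map Option.some := by
  have hW := h.weight_eq_of_nil
  ext o
  cases o with
  | none =>
    rw [h.none, hW, if_neg (frobSq_ne_zero hB), PMF.map_apply]
    simp
  | some y =>
    rw [h.some, hW, PMF.map_apply, tsum_eq_single y]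
    · simp [indexLaw, prob]
    · intro x hx
      exact if_neg fun h => hx (Option.some_injective _ h).symm

theorem IsReservoirLaw.eq_pure_of_nil {W : ℝ} {q : PMF (Option (Fin n × Fin n))}
    (h : IsReservoirLaw (0 : Matrix (Fin n) (Fin n) ℝ) [] W q) : q = PMF.pure Option.none := by
  have hW := h.weight
  simp only [Matrix.zero_apply] at hW
  ext o
  cases o with
  | none => rw [h.none, hW]; simp
  | some y => rw [h.some]; simp

theorem reservoir_result_none (B : Matrix (Fin n) (Fin n) ℝ) (W v τ : ℝ) :
    (reservoir s τ).result n (memOf B W v fun _ : Fin s => none) = 0 := by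
  ext i j
  rw [Program.result, of_apply]
  simp [reservoir, List.map_ofFn, List.sum_ofFn, RExpr.eval, memOf]

theorem reservoir_result_some (B : Matrix (Fin n) (Fin n) ℝ) (v τ : ℝ)
    (x : Fin s → Fin n × Fin n) :
    (reservoir s τ).result n (memOf B (frobSq B) v fun t => some (x t)) = sketch B s x := by
  ext i j
  rw [Program.result, of_apply, sketch, Matrix.smul_apply, Matrix.sum_apply, smul_eq_mul,
    Finset.mul_sum]
  simp only [reservoir, List.map_ofFn, List.sum_ofFn, Function.comp, memOf, Fin.append_left,
    Fin.append_right, Option.elim_some, RExpr.eval, Fin.cons_zero, Fin.cons_succ, Fin.val_inj]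
  refine Finset.sum_congr rfl fun t _ => ?_
  rw [single_apply]
  split_ifs
  · by_cases h : B (x t).1 (x t).2 = 0
    · simp [h]
    · rw [prob]
      field_simp
  · rw [mul_zero]

theorem reservoir_scan {A : Matrix (Fin n) (Fin n) ℝ} {ε : ℝ} (hn : 1 ≤ n) (hε : 0 < ε)
    {l : List (Fin n × Fin n)} (hl : l.Nodup) {W : ℝ} (v : ℝ)
    {q : PMF (Option (Fin n × Fin n))} (h : IsReservoirLaw (trunc A ε) l W q) :
    ((iid q s).bind fun o => (reservoir s (ε / (2 * n))).scan
      (l.map fun x => ((x.1 : ℕ), (x.2 : ℕ), A x.1 x.2)) (memOf (trunc A ε) W v o)).map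
        ((reservoir s (ε / (2 * n))).result n) = sketchLaw A ε s := by
  induction l generalizing W v q with
  | nil =>
    simp only [List.map_nil, Program.scan]
    rw [sketchLaw]
    split_ifs with hB
    · rw [hB] at h ⊢
      rw [h.eq_pure_of_nil, iid_pure, PMF.pure_bind, PMF.pure_map, reservoir_result_none]
    · have hiid : iid q s = (iid (indexLaw (trunc A ε) hB) s).map fun x t => some (x t) := by
        have := iid_bind_iid_map (indexLaw (trunc A ε) hB) (PMF.pure ())
          (fun a _ => Option.some a) s
        simp only [iid_pure, PMF.pure_map] at this
        rw [h.eq_indexLaw_of_nil hB]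
        exact this.symm
      rw [hiid, PMF.bind_map, PMF.map_bind]
      simp only [Function.comp, PMF.pure_map, h.weight_eq_of_nil, reservoir_result_some]
      rfl
  | cons a l ih =>
    obtain ⟨hal, hl⟩ := List.nodup_cons.1 hl
    simp only [List.map_cons, Program.scan]
    by_cases ha : trunc A ε a.1 a.2 = 0
    · simp only [reservoir_body_exec_of_eq_zero hn hε ha, PMF.pure_bind]
      exact ih hl _ (h.of_cons_eq_zero ha)
    · simp only [reservoir_body_exec_of_ne_zero ha, keepCmd_exec, PMF.bind_map]
      rw [← ih hl (trunc A ε a.1 a.2) (h.of_cons_ne_zero hal ha), ← iid_bind_iid_map]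
      simp only [PMF.bind_bind, PMF.bind_map]
      rfl

theorem reservoir_run (A : Matrix (Fin n) (Fin n) ℝ) {ε : ℝ} (hn : 1 ≤ n) (hε : 0 < ε)
    {l : List (Fin n × Fin n)} (hl : l.Nodup) (hall : ∀ x, x ∈ l) :
    (reservoir s (ε / (2 * n))).run A l = sketchLaw A ε s := by
  rw [← reservoir_scan hn hε hl 0 (IsReservoirLaw.of_all_mem hall), iid_pure, PMF.pure_bind,
    Program.run]
  congr 2
  have h1 : Fin.append (fun _ : Fin s => 0) (fun _ : Fin s => 0) = fun _ => 0 := by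
    funext i
    induction i using Fin.addCases <;> simp only [Fin.append_left, Fin.append_right]
  have h2 : (Fin.cons 0 (Fin.cons 0 fun _ => 0) : Fin (s + 2) → ℝ) = fun _ => 0 := by
    funext i
    cases i using Fin.cases with
    | zero => rfl
    | succ i => cases i using Fin.cases <;> rfl
  simp only [memOf, Option.elim_none]
  rw [h1, h2]

/-- With no samples, the output is zero and no memory is needed. -/
def emptyProgram : Program where
  k := 0
  m := 0
  body := .skip
  out := []

theorem emptyProgram_run (A : Matrix (Fin n) (Fin n) ℝ) (ε : ℝ) (l : List (Fin n × Fin n)) :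
    emptyProgram.run A l = sketchLaw A ε 0 := by
  have h1 : ∀ M, emptyProgram.result n M = 0 := fun M => by
    ext i j
    simp [emptyProgram, Program.result]
  have h2 : emptyProgram.run A l = PMF.pure 0 := by
    rw [Program.run, show emptyProgram.result n = Function.const _ 0 from funext h1]
    exact PMF.map_const _ _
  have h3 : ∀ B : Matrix (Fin n) (Fin n) ℝ, sketch B 0 = Function.const _ 0 := fun B => by
    funext x
    simp [sketch]
  rw [h2, sketchLaw]
  split_ifs
  · rfl
  · rw [h3]
    exact (PMF.map_const _ _).symm

end Reservoir

end Sparsify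

theorem theorem1 :
    -- accuracy and sparsity
    (∀ (n : ℕ) (_hn : 1 ≤ n) (A : Matrix (Fin n) (Fin n) ℝ) (ε : ℝ) (_hε : 0 < ε) (s : ℕ)
        (_hs : 28 * n * Real.log (Real.sqrt 2 * n) / ε ^ 2 * Sparsify.frobSq A ≤ (s : ℝ)),
      ENNReal.ofReal (1 - 1 / (n : ℝ)) ≤
          (Sparsify.sketchLaw A ε s).toOuterMeasure {M | Sparsify.specNorm (A - M) ≤ ε} ∧
        ∀ M ∈ (Sparsify.sketchLaw A ε s).support, Sparsify.nnz M ≤ s) ∧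
    -- implementation in one pass over the entries, in any order, with memory `O(s)`
    (∃ C : ℕ, ∀ (n : ℕ) (_hn : 1 ≤ n) (ε : ℝ) (_hε : 0 < ε) (s : ℕ),
      ∃ P : Sparsify.Program, P.memory ≤ C * s ∧
        ∀ (A : Matrix (Fin n) (Fin n) ℝ) (l : List (Fin n × Fin n)),
          l.Nodup → (∀ x, x ∈ l) → P.run A l = Sparsify.sketchLaw A ε s) := by
  refine ⟨fun n hn A ε hε s hs => ⟨Sparsify.le_sketchLaw_specNorm_le hn A hε hs,
    fun M hM => Sparsify.nnz_le_of_mem_support hM⟩, 5, fun n hn ε hε s => ?_⟩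
  rcases Nat.eq_zero_or_pos s with rfl | hs
  · exact ⟨Sparsify.emptyProgram, le_rfl, fun A l _ _ => Sparsify.emptyProgram_run A ε l⟩
  · refine ⟨Sparsify.reservoir s (ε / (2 * n)), ?_, fun A l hl hall =>
      Sparsify.reservoir_run A hn hε hl hall⟩
    -- `2 s` index registers and `s + 2` real registers
    change s + s + (s + 2) ≤ 5 * s
    omega
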